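/- Fix $p\ge 1$, $\mu\in\mathbb R^p$ and a positive semidefinite covariance matrix $\Sigma\in\mathbb R^{p\times p}$, $\Sigma\neq 0$. For sample sizes $n,m\ge 2$ and a weight $w\in[0,1]$ consider the following recursive training. At step $0$, $\mu_0$ and $\Sigma_0$ are the sample mean and the sample covariance (with normalisation $1/(n-1)$) of $n$ i.i.d. draws from $N(\mu,\Sigma)$. At step $t\ge1$, given the past, draw independently $n$ fresh real points i.i.d. from $N(\mu,\Sigma)$ and $m$ synthetic points i.i.d. from $N(\mu_{t-1},\Sigma_{t-1})$; let $\widehat\mu_t,\widehat S_t$ and $\widetilde\mu_t,\widetilde S_t$ be the sample means and sample covariances (with normalisations $1/(n-1)$ and $1/(m-1)$) of the real and of the synthetic points, and put $\mu_t=w\widehat\mu_t+(1-w)\widetilde\mu_t$ and $\Sigma_t=w\widehat S_t+(1-w)\widetilde S_t$. Let $\mathrm{Err}(\mu_t)=\mathbb E\|\mu_t-\mu\|_2^2$ and $\mathrm{Err}(\Sigma_t)=\mathbb E\|\Sigma_t-\Sigma\|_F^2$ (in $[0,\infty]$). The limits $\mathrm{Err}(\mu_\infty(w))=\lim_{t\to\infty}\mathrm{Err}(\mu_t)$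 and $\mathrm{Err}(\Sigma_\infty(w))=\lim_{t\to\infty}\mathrm{Err}(\Sigma_t)$ exist in $[0,\infty]$; they depend also on $n,m$. For $k>0$ put $$C(w,k)=\frac{w^2+(1-w)^2k}{2w-w^2}\ \ (0<w\le1),\qquad w^\star(k)=\frac{\sqrt{k^2+4k}-k}{2}.$$ 1. (Fully synthetic: model collapse.) For all $n,m\ge2$, $\lim_{w\to0^+}\mathrm{Err}(\mu_\infty(w))=\infty$ and $\lim_{w\to0^+}\mathrm{Err}(\Sigma_\infty(w))=\infty$. 2. (Real data only.) For all $n,m\ge2$, $\mathrm{Err}(\mu_\infty(1))=\dfrac{\mathrm{tr}(\Sigma)}{n}$ and $\mathrm{Err}(\Sigma_\infty(1))=\dfrac{\mathrm{tr}(\Sigma^2)+\mathrm{tr}^2(\Sigma)}{n-1}$. 3. (Optimal weight for the mean.) For all $n,m\ge2$, with $k=n/m$, the unique minimizer of $w\mapsto\mathrm{Err}(\mu_\infty(w))$ on $[0,1]$ is $w^\star=w^\star(k)$, and $\mathrm{Err}(\mu_\infty(w^\star))=\dfrac{w^\star\,\mathrm{tr}(\Sigma)}{n}$. 4. (Asymptotically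 optimal weight for the covariance.) Let $k>0$ be real. For each fixed $w\in(0,1]$, as $n,m\to\infty$ with $n/m\to k$, $\mathrm{Err}(\Sigma_\infty(w))$ is eventually finite and $$\mathrm{Err}(\Sigma_\infty(w))=\frac{C(w,k)\,[\mathrm{tr}(\Sigma^2)+\mathrm{tr}^2(\Sigma)]}{n}+o(n^{-1}).$$ The leading coefficient $C(w,k)\,[\mathrm{tr}(\Sigma^2)+\mathrm{tr}^2(\Sigma)]$ is uniquely minimized over $w\in(0,1]$ at $w^\star(k)\in(0,1]$; and for each fixed $w\in[0,1]$ with $w\ne w^\star(k)$ one has $\mathrm{Err}(\Sigma_\infty(w^\star(k)))<\mathrm{Err}(\Sigma_\infty(w))$ for all sufficiently large $n,m$ with $n/m$ sufficiently close to $k$. 5. (Improvement.) For all $n,m\ge2$, with $k=n/m$ and $w^\star=w^\star(k)$, $\mathrm{Err}(\mu_\infty(w^\star))/\mathrm{Err}(\mu_\infty(1))=w^\star(k)$. For every real $k>0$, $$\lim_{\substack{n,m\to\infty\\ n/m\to k}}\frac{\mathrm{Err}(\mu_\infty(w^\star(k)))}{\mathrm{Err}(\mu_\infty(1))}=\lim_{\substack{n,m\to\infty\\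 n/m\to k}}\frac{\mathrm{Err}(\Sigma_\infty(w^\star(k)))}{\mathrm{Err}(\Sigma_\infty(1))}=w^\star(k)<1.$$ -/

import Mathlib

open MeasureTheory ProbabilityTheory Filter Topology Asymptotics
open scoped ENNReal

noncomputable section

namespace RecursiveGaussian

/-- The Borel sigma-algebra on square real matrices (entrywise). -/
instance instMeasurableSpaceMatrix (p : ℕ) : MeasurableSpace (Matrix (Fin p) (Fin p) ℝ) :=
  inferInstanceAs (MeasurableSpace (Fin p → Fin p → ℝ))

instance instBorelSpaceMatrix (p : ℕ) : BorelSpace (Matrix (Fin p) (Fin p) ℝ) :=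
  inferInstanceAs (BorelSpace (Fin p → Fin p → ℝ))

instance instPolishSpaceMatrix (p : ℕ) : PolishSpace (Matrix (Fin p) (Fin p) ℝ) :=
  inferInstanceAs (PolishSpace (Fin p → Fin p → ℝ))

/-- Parameters of a Gaussian distribution on `ℝ^p`: a mean vector and a covariance matrix. -/
abbrev Params (p : ℕ) : Type :=
  EuclideanSpace ℝ (Fin p) × Matrix (Fin p) (Fin p) ℝ

/-- A dataset of `N` points of `ℝ^p`. -/
abbrev Dataset (p N : ℕ) : Type := Fin N → EuclideanSpace ℝ (Fin p)

/-- Sample mean `(1 / N) ∑ xᵢ`. -/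
def sampleMean {p N : ℕ} (x : Dataset p N) : EuclideanSpace ℝ (Fin p) :=
  (1 / (N : ℝ)) • ∑ i, x i

/-- Sample covariance `(1 / (N - 1)) ∑ (xᵢ - x̄) (xᵢ - x̄)ᵀ`. -/
def sampleCov {p N : ℕ} (x : Dataset p N) : Matrix (Fin p) (Fin p) ℝ :=
  (1 / ((N : ℝ) - 1)) •
    ∑ i, Matrix.vecMulVec (x i - sampleMean x).ofLp (x i - sampleMean x).ofLp

/-- The parameters estimated from a single dataset (used at the initial step). -/
def fit {p N : ℕ} (x : Dataset p N) : Params p := (sampleMean x, sampleCov x)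

/-- The weighted estimator computed from a real dataset (weight `w`) and a synthetic dataset
(weight `1 - w`). -/
def weightedFit {p n m : ℕ} (w : ℝ) (d : Dataset p n × Dataset p m) : Params p :=
  (w • sampleMean d.1 + (1 - w) • sampleMean d.2,
    w • sampleCov d.1 + (1 - w) • sampleCov d.2)

lemma measurable_sampleMean {p N : ℕ} :
    Measurable (sampleMean : Dataset p N → EuclideanSpace ℝ (Fin p)) := by
  unfold sampleMean
  fun_prop

lemma measurable_sampleCov {p N : ℕ} :
    Measurable (sampleCov : Dataset p N → Matrix (Fin p) (Fin p) ℝ) := by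
  have hm := measurable_sampleMean (p := p) (N := N)
  refine measurable_pi_lambda _ fun a => measurable_pi_lambda _ fun b => ?_
  have : (fun x : Dataset p N => sampleCov x a b) = fun x =>
      (1 / ((N : ℝ) - 1)) *
        ∑ i, (x i - sampleMean x).ofLp a * (x i - sampleMean x).ofLp b := by
    funext x
    simp [sampleCov, Matrix.sum_apply, Matrix.vecMulVec_apply]
  change Measurable (fun x : Dataset p N => sampleCov x a b)
  rw [this]
  fun_prop

lemma measurable_fit {p N : ℕ} : Measurable (fit : Dataset p N → Params p) :=
  measurable_sampleMean.prodMk measurable_sampleCov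

lemma measurable_weightedFit {p n m : ℕ} (w : ℝ) :
    Measurable (weightedFit w : Dataset p n × Dataset p m → Params p) := by
  have h1 := measurable_sampleMean (p := p) (N := n)
  have h2 := measurable_sampleMean (p := p) (N := m)
  have h3 := measurable_sampleCov (p := p) (N := n)
  have h4 := measurable_sampleCov (p := p) (N := m)
  refine Measurable.prodMk (by fun_prop) ?_
  refine measurable_pi_lambda _ fun a => measurable_pi_lambda _ fun b => ?_
  have e1 : Measurable fun x : Dataset p n => sampleCov x a b :=
    (measurable_pi_apply b).comp ((measurable_pi_apply a).comp h3)
  have e2 : Measurable fun x : Dataset p m => sampleCov x a b :=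
    (measurable_pi_apply b).comp ((measurable_pi_apply a).comp h4)
  exact ((e1.comp measurable_fst).const_mul w).add ((e2.comp measurable_snd).const_mul (1 - w))

section Sqrt

open scoped MatrixOrder

lemma isClosed_nonneg (p : ℕ) : IsClosed {S : Matrix (Fin p) (Fin p) ℝ | 0 ≤ S} := by
  have h : {S : Matrix (Fin p) (Fin p) ℝ | 0 ≤ S} = {S | S.conjTranspose = S} ∩
      ⋂ x : Fin p → ℝ, {S | 0 ≤ star x ⬝ᵥ (S.mulVec x)} := by
    ext S
    simp only [Set.mem_ofPred_eq, Matrix.nonneg_iff_posSemidef, Set.mem_inter_iff, Set.mem_iInter]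
    exact Matrix.posSemidef_iff_dotProduct_mulVec
  rw [h]
  refine (isClosed_eq (by fun_prop) continuous_id).inter (isClosed_iInter fun x => ?_)
  exact isClosed_le continuous_const (by fun_prop)

/-- The positive semidefinite square root is a Borel function (it inverts the injective continuous
map `T ↦ T * T` on the closed cone of positive semidefinite matrices). -/
lemma measurable_sqrt (p : ℕ) :
    Measurable (CFC.sqrt : Matrix (Fin p) (Fin p) ℝ → Matrix (Fin p) (Fin p) ℝ) := by
  classical
  let P : Set (Matrix (Fin p) (Fin p) ℝ) := {S | 0 ≤ S}
  have : PolishSpace P := (isClosed_nonneg p).polishSpace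
  let f : P → Matrix (Fin p) (Fin p) ℝ := fun T => T.1 * T.1
  have hf : Measurable f := by
    have : Continuous f := by fun_prop
    exact this.measurable
  have hinj : Function.Injective f := by
    intro S T h
    have h' : S.1 * S.1 = T.1 * T.1 := h
    apply Subtype.ext
    rw [← CFC.sqrt_mul_self S.1 S.2, ← CFC.sqrt_mul_self T.1 T.2, h']
  have hemb := hf.measurableEmbedding hinj
  have : (CFC.sqrt : Matrix (Fin p) (Fin p) ℝ → Matrix (Fin p) (Fin p) ℝ) =
      Function.extend f Subtype.val (fun _ => 0) := by
    funext S
    by_cases hS : 0 ≤ S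
    · have hS' : f ⟨CFC.sqrt S, CFC.sqrt_nonneg S⟩ = S := CFC.sqrt_mul_sqrt_self S hS
      conv_rhs => rw [← hS']
      rw [hinj.extend_apply]
    · rw [Function.extend_apply', CFC.sqrt, cfcₙ_apply_of_not_predicate _ hS]
      rintro ⟨T, rfl⟩
      refine hS ?_
      have hT : T.1.conjTranspose = T.1 :=
        (Matrix.nonneg_iff_posSemidef.1 T.2).isHermitian
      have := Matrix.posSemidef_conjTranspose_mul_self T.1
      rw [hT] at this
      exact this.nonneg
  rw [this]
  exact hemb.measurable_extend measurable_subtype_coe measurable_const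


lemma measurable_dataset (p N : ℕ) : Measurable fun θ : Params p =>
    Measure.pi fun _ : Fin N => multivariateGaussian θ.1 θ.2 := by
  have hsqrt := measurable_sqrt p
  have key : Measurable fun q : Params p × EuclideanSpace ℝ (Fin p) =>
      q.1.1 + Matrix.toEuclideanCLM (𝕜 := ℝ) (CFC.sqrt q.1.2) q.2 := by
    have hc : Continuous fun r : Matrix (Fin p) (Fin p) ℝ × EuclideanSpace ℝ (Fin p) =>
        Matrix.toEuclideanCLM (𝕜 := ℝ) r.1 r.2 := by
      have : (fun r : Matrix (Fin p) (Fin p) ℝ × EuclideanSpace ℝ (Fin p) =>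
          Matrix.toEuclideanCLM (𝕜 := ℝ) r.1 r.2) =
          fun r => WithLp.toLp 2 (r.1.mulVec r.2.ofLp) := by
        funext r; rfl
      rw [this]
      fun_prop
    have h2 := hc.measurable.comp
      (((hsqrt.comp measurable_snd).comp measurable_fst).prodMk measurable_snd :
        Measurable fun q : Params p × EuclideanSpace ℝ (Fin p) => (CFC.sqrt q.1.2, q.2))
    exact (measurable_fst.comp measurable_fst).add h2
  have hmap : ∀ θ : Params p, (Measure.pi fun _ : Fin N => multivariateGaussian θ.1 θ.2) =
      (Measure.pi fun _ : Fin N => stdGaussian (EuclideanSpace ℝ (Fin p))).map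
        fun z i => θ.1 + Matrix.toEuclideanCLM (𝕜 := ℝ) (CFC.sqrt θ.2) (z i) := by
    intro θ
    have hθ : Measurable fun z : EuclideanSpace ℝ (Fin p) =>
        θ.1 + Matrix.toEuclideanCLM (𝕜 := ℝ) (CFC.sqrt θ.2) z := by fun_prop
    exact (Measure.pi_map_pi (fun _ => hθ.aemeasurable)).symm
  have hjoint : Measurable fun q : Params p × Dataset p N => fun i =>
      q.1.1 + Matrix.toEuclideanCLM (𝕜 := ℝ) (CFC.sqrt q.1.2) (q.2 i) := by
    refine measurable_pi_lambda _ fun i => ?_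
    exact key.comp (measurable_fst.prodMk ((measurable_pi_apply i).comp measurable_snd))
  refine Measure.measurable_of_measurable_coe _ fun s hs => ?_
  have : (fun θ : Params p => (Measure.pi fun _ : Fin N => multivariateGaussian θ.1 θ.2) s) =
      fun θ => (Measure.pi fun _ : Fin N => stdGaussian (EuclideanSpace ℝ (Fin p)))
        (Prod.mk θ ⁻¹' ((fun q : Params p × Dataset p N => fun i =>
          q.1.1 + Matrix.toEuclideanCLM (𝕜 := ℝ) (CFC.sqrt q.1.2) (q.2 i)) ⁻¹' s)) := by
    funext θ
    rw [hmap θ]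
    exact Measure.map_apply (hjoint.comp measurable_prodMk_left) hs
  rw [this]
  exact measurable_measure_prodMk_left (hjoint hs)

end Sqrt

/-- The law of a dataset of `N` independent draws from `N(θ.1, θ.2)`, as a Markov kernel in the
parameters `θ`. -/
def dataset (p N : ℕ) : Kernel (Params p) (Dataset p N) where
  toFun θ := Measure.pi fun _ => multivariateGaussian θ.1 θ.2
  measurable' := measurable_dataset p N

instance instIsMarkovKernelDataset (p N : ℕ) : IsMarkovKernel (dataset p N) :=
  ⟨fun θ => by change IsProbabilityMeasure (Measure.pi _); infer_instance⟩

/-- One training step, as a Markov kernel: given the current parameters `θ'`, draw `n` fresh real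
points from `N(θ.1, θ.2)` and, independently, `m` synthetic points from `N(θ'.1, θ'.2)`, and
return the weighted estimator. -/
def step {p : ℕ} (θ : Params p) (n m : ℕ) (w : ℝ) : Kernel (Params p) (Params p) :=
  (Kernel.prod (Kernel.const _ (dataset p n θ)) (dataset p m)).map (weightedFit w)

instance instIsMarkovKernelStep {p : ℕ} (θ : Params p) (n m : ℕ) (w : ℝ) :
    IsMarkovKernel (step θ n m w) :=
  Kernel.IsMarkovKernel.map _ (measurable_weightedFit w)

/-- The law of the parameters `(μ_t, Σ_t)` estimated at the `t`-th training step, when the real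
data have distribution `N(θ.1, θ.2)`: initially the parameters are fitted on `n` real points. -/
def paramLaw {p : ℕ} (θ : Params p) (n m : ℕ) (w : ℝ) : ℕ → Measure (Params p)
  | 0 => (dataset p n θ).map fit
  | t + 1 => (paramLaw θ n m w t).bind (step θ n m w)

instance instIsProbabilityMeasureParamLaw {p : ℕ} (θ : Params p) (n m : ℕ) (w : ℝ) (t : ℕ) :
    IsProbabilityMeasure (paramLaw θ n m w t) := by
  induction t with
  | zero => exact Measure.isProbabilityMeasure_map measurable_fit.aemeasurable
  | succ t ih => rw [paramLaw]; infer_instance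

/-- `Err(μ_t) = E ‖μ_t - μ‖₂²`, with values in `[0, ∞]`. -/
def errMean {p : ℕ} (θ : Params p) (n m : ℕ) (w : ℝ) (t : ℕ) : ℝ≥0∞ :=
  ∫⁻ η, ENNReal.ofReal (‖η.1 - θ.1‖ ^ 2) ∂(paramLaw θ n m w t)

/-- `Err(Σ_t) = E ‖Σ_t - Σ‖_F²` (Frobenius norm), with values in `[0, ∞]`. -/
def errCov {p : ℕ} (θ : Params p) (n m : ℕ) (w : ℝ) (t : ℕ) : ℝ≥0∞ :=
  ∫⁻ η, ENNReal.ofReal (∑ i, ∑ j, (η.2 i j - θ.2 i j) ^ 2) ∂(paramLaw θ n m w t)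

/-- `Err(μ_∞)`: the limit of `Err(μ_t)` as `t → ∞` in `[0, ∞]`, written as an upper limit, which
equals the limit whenever the limit exists. -/
def errMeanLim {p : ℕ} (θ : Params p) (n m : ℕ) (w : ℝ) : ℝ≥0∞ :=
  limsup (errMean θ n m w) atTop

/-- `Err(Σ_∞)`: the limit of `Err(Σ_t)` as `t → ∞` in `[0, ∞]`, written as an upper limit, which
equals the limit whenever the limit exists. -/
def errCovLim {p : ℕ} (θ : Params p) (n m : ℕ) (w : ℝ) : ℝ≥0∞ :=
  limsup (errCov θ n m w) atTop

/-- `C(w, k) = (w² + (1 - w)² k) / (2 w - w²)`. -/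
def weightConst (w k : ℝ) : ℝ := (w ^ 2 + (1 - w) ^ 2 * k) / (2 * w - w ^ 2)

/-- `w⋆(k) = (√(k² + 4 k) - k) / 2`. -/
def optWeight (k : ℝ) : ℝ := (Real.sqrt (k ^ 2 + 4 * k) - k) / 2

/-- The filter on pairs `(n, m)` of sample sizes for `n, m → ∞` with `n / m → k`. -/
def proportional (k : ℝ) : Filter (ℕ × ℕ) :=
  (atTop ×ˢ atTop) ⊓ comap (fun q : ℕ × ℕ => (q.1 : ℝ) / q.2) (𝓝 k)

end RecursiveGaussian

end

/-! ### Fourth moments of Gaussian functionals -/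

namespace RecursiveGaussian

/-! Everything reduces to linear recursions for second moments. Given the current parameters, the
error of the next estimate is a weighted sum of real sampling noise, synthetic sampling noise and
inherited error. The two noises are independent and centred, so the cross terms vanish in mean
square. The estimate of the covariance stays unbiased, hence the mean error obeys a scalar affine
recursion with ratio `(1 - w)²` and limit `weightConst w (n/m) * tr S / n`.

For a Gaussian sample, Isserlis' theorem gives the covariance of two entries of the sample
covariance (`hasExpectation_sampleCov_mul`). The synthetic noise in the Frobenius error `u`
therefore involves `E (tr Σ_t)²`, so `u` alone does not satisfy a closed recursion. Adding the trace
error `v` closes the system (`HasMoments.step`). It is diagonalised by `2u + v` and `u - v`, with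
ratios `(1 - w)² (1 + 2/(m-1))` and `(1 - w)² (1 - 1/(m-1))` (`hasMoments_paramLaw`). The second
ratio is always below `1`, so the covariance error has a finite limit exactly when the first one is.
Near `w = 0` it exceeds `1` and the limit is infinite.

As `m → ∞` both ratios tend to `(1 - w)²`, so the covariance error has the same leading factor `C(w,
k)` as the mean error (`tendsto_mul_covLimit`). Completing the square in `C(w, k) - w⋆`
(`weightConst_sub_optWeight`) identifies the minimizer and shows that the minimum value is `w⋆`
itself. -/

lemma integral_pow_four_gaussianReal (v : NNReal) :
    ∫ x, x ^ 4 ∂(gaussianReal 0 v) = 3 * (v : ℝ) ^ 2 := by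
  have h : ∫ x, x ^ 4 ∂(gaussianReal 0 v) =
      iteratedDeriv 4 (mgf (fun x ↦ x) (gaussianReal 0 v)) 0 := by
    rw [iteratedDeriv_mgf_zero] <;> simp
  -- Differentiating a polynomial `q` times the moment generating function replaces `q` by `q' + v t
  -- q`. Four applications starting from `q = 1` give the fourth derivative, whose value at `0` is
  -- the moment.
  have hd : ∀ q q' : ℝ → ℝ, (∀ t, HasDerivAt q (q' t) t) →
      deriv (fun t ↦ q t * Real.exp ((v : ℝ) * t ^ 2 / 2)) =
        fun t ↦ (q' t + q t * (v * t)) * Real.exp ((v : ℝ) * t ^ 2 / 2) := by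
    intro q q' hq
    funext t
    have h1 : HasDerivAt (fun t : ℝ ↦ (v : ℝ) * t ^ 2 / 2) (v * t) t := by
      have := (((hasDerivAt_id t).pow 2).const_mul (v : ℝ)).div_const 2
      refine this.congr_deriv ?_
      simp
      ring
    refine (((hq t).mul h1.exp).deriv.trans ?_)
    ring
  have e0 : mgf (fun x ↦ x) (gaussianReal 0 v) =
      fun t ↦ 1 * Real.exp ((v : ℝ) * t ^ 2 / 2) := by
    rw [mgf_fun_id_gaussianReal]; simp
  rw [h, e0, iteratedDeriv_succ, iteratedDeriv_succ, iteratedDeriv_succ, iteratedDeriv_one,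
    hd (fun _ ↦ 1) (fun _ ↦ 0) (fun t ↦ hasDerivAt_const t 1),
    hd (fun t ↦ 0 + 1 * (v * t)) (fun _ ↦ v) (fun t ↦ by
      simpa using (hasDerivAt_id t).const_mul (v : ℝ)),
    hd (fun t ↦ v + (0 + 1 * (v * t)) * (v * t)) (fun t ↦ 2 * v ^ 2 * t) (fun t ↦ by
      have := (((hasDerivAt_id t).pow 2).const_mul ((v : ℝ) ^ 2)).const_add (v : ℝ)
      refine (this.congr_deriv ?_).congr_of_eventuallyEq (.of_forall fun s ↦ ?_)
      · simp; ring
      · simp; ring),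
    hd _ (fun t ↦ 3 * v ^ 2 + 3 * v ^ 3 * t ^ 2) (fun t ↦ by
      have h1 := ((hasDerivAt_id t).const_mul (3 * (v : ℝ) ^ 2))
      have h2 := (((hasDerivAt_id t).pow 3).const_mul ((v : ℝ) ^ 3))
      refine ((h1.add h2).congr_deriv ?_).congr_of_eventuallyEq (.of_forall fun s ↦ ?_)
      · simp; ring
      · simp; ring)]
  simp

section HasExpectation

variable {α : Type*} [MeasurableSpace α]

/-- `f` is integrable under `P`, with integral `c`. -/
def HasExpectation (P : Measure α) (f : α → ℝ) (c : ℝ) : Prop :=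
  Integrable f P ∧ ∫ x, f x ∂P = c

namespace HasExpectation

variable {P : Measure α} {f g : α → ℝ} {a b : ℝ}

lemma of_integrable (hf : Integrable f P) : HasExpectation P f (∫ x, f x ∂P) := ⟨hf, rfl⟩

lemma add (hf : HasExpectation P f a) (hg : HasExpectation P g b) :
    HasExpectation P (fun x ↦ f x + g x) (a + b) :=
  ⟨hf.1.add hg.1, by rw [integral_add hf.1 hg.1, hf.2, hg.2]⟩

lemma sub (hf : HasExpectation P f a) (hg : HasExpectation P g b) :
    HasExpectation P (fun x ↦ f x - g x) (a - b) :=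
  ⟨hf.1.sub hg.1, by rw [integral_sub hf.1 hg.1, hf.2, hg.2]⟩

lemma const_mul (r : ℝ) (hf : HasExpectation P f a) :
    HasExpectation P (fun x ↦ r * f x) (r * a) :=
  ⟨hf.1.const_mul r, by rw [integral_const_mul, hf.2]⟩

lemma const [IsProbabilityMeasure P] (r : ℝ) : HasExpectation P (fun _ ↦ r) r :=
  ⟨integrable_const r, by simp⟩

lemma sum {ι : Type*} (s : Finset ι) {f : ι → α → ℝ} {a : ι → ℝ}
    (h : ∀ i ∈ s, HasExpectation P (f i) (a i)) :
    HasExpectation P (fun x ↦ ∑ i ∈ s, f i x) (∑ i ∈ s, a i) :=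
  ⟨integrable_finsetSum s fun i hi ↦ (h i hi).1, by
    rw [integral_finsetSum s fun i hi ↦ (h i hi).1]
    exact Finset.sum_congr rfl fun i hi ↦ (h i hi).2⟩

lemma congr (hf : HasExpectation P f a) (hfg : ∀ x, g x = f x) (hab : b = a) :
    HasExpectation P g b := by
  rwa [funext hfg, hab]

lemma map {β : Type*} [MeasurableSpace β] {Q : Measure β} {φ : β → α} (hφ : Measurable φ)
    (hf : Measurable f) (h : HasExpectation Q (fun y ↦ f (φ y)) a) :
    HasExpectation (Q.map φ) f a :=
  ⟨(integrable_map_measure hf.aestronglyMeasurable hφ.aemeasurable).2 h.1, by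
    rw [integral_map hφ.aemeasurable hf.aestronglyMeasurable, h.2]⟩

lemma prod_mul {β : Type*} [MeasurableSpace β] {Q : Measure β} [SFinite P] [SFinite Q] {g : β → ℝ}
    (hf : HasExpectation P f a) (hg : HasExpectation Q g b) :
    HasExpectation (P.prod Q) (fun z ↦ f z.1 * g z.2) (a * b) :=
  ⟨hf.1.mul_prod hg.1, by rw [integral_prod_mul, hf.2, hg.2]⟩

lemma lintegral_ofReal (hf : HasExpectation P f a) (h0 : ∀ x, 0 ≤ f x) :
    ∫⁻ x, ENNReal.ofReal (f x) ∂P = ENNReal.ofReal a := by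
  rw [← ofReal_integral_eq_lintegral_ofReal hf.1 (.of_forall h0), hf.2]

end HasExpectation

end HasExpectation

section Isserlis

variable {E : Type*} [NormedAddCommGroup E] [NormedSpace ℝ E] [MeasurableSpace E] [BorelSpace E]

lemma integrable_dual_mul (P : Measure E) [IsGaussian P] (L M : StrongDual ℝ E) :
    Integrable (fun x ↦ L x * M x) P :=
  (IsGaussian.memLp_dual P L 2 (by simp)).integrable_mul (IsGaussian.memLp_dual P M 2 (by simp))

/-- The image of `P` under `L` is a centred real Gaussian of variance `c`, so the scalar fourth
moment applies. -/
lemma hasExpectation_dual_pow_four (P : Measure E) [IsGaussian P] {L : StrongDual ℝ E} {c : ℝ}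
    (hL : ∫ x, L x ∂P = 0) (hc : HasExpectation P (fun x ↦ L x * L x) c) :
    HasExpectation P (fun x ↦ L x ^ 4) (3 * c ^ 2) := by
  constructor
  · have := (IsGaussian.memLp_dual P L (4 : ℕ) (by simp)).integrable_norm_pow (by norm_num)
    refine this.congr (.of_forall fun x ↦ ?_)
    simp [Even.pow_abs (show Even 4 by decide)]
  · have h1 : ∫ x, L x ^ 4 ∂P = ∫ y, y ^ 4 ∂(P.map L) := by
      rw [integral_map (by fun_prop) (by fun_prop)]
    have hv : Var[L; P] = c := by
      rw [variance_of_integral_eq_zero (by fun_prop) hL, ← hc.2]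
      simp [sq]
    rw [h1, IsGaussian.map_eq_gaussianReal, hL, integral_pow_four_gaussianReal,
      Real.coe_toNNReal _ (variance_nonneg _ _), hv]

/-- The fourth-order polarization identity. -/
lemma polarization_four (a b c d : ℝ) :
    a * b * (c * d) = (1 / 192) * ((a + b + c + d) ^ 4 - (a + b + c - d) ^ 4
      - (a + b - c + d) ^ 4 + (a + b - c - d) ^ 4 - (a - b + c + d) ^ 4 + (a - b + c - d) ^ 4
      + (a - b - c + d) ^ 4 - (a - b - c - d) ^ 4) := by
  ring

/-- Isserlis' theorem for four centred linear functionals of a Gaussian measure. -/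
lemma hasExpectation_dual_mul_four (P : Measure E) [IsGaussian P] {A B C D : StrongDual ℝ E}
    (hA : ∫ x, A x ∂P = 0) (hB : ∫ x, B x ∂P = 0) (hC : ∫ x, C x ∂P = 0)
    (hD : ∫ x, D x ∂P = 0) :
    HasExpectation P (fun x ↦ A x * B x * (C x * D x))
      ((∫ x, A x * B x ∂P) * (∫ x, C x * D x ∂P) + (∫ x, A x * C x ∂P) * (∫ x, B x * D x ∂P) +
        (∫ x, A x * D x ∂P) * (∫ x, B x * C x ∂P)) := by
  have i1 (L : StrongDual ℝ E) (h : ∫ x, L x ∂P = 0) : HasExpectation P L 0 :=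
    ⟨IsGaussian.integrable_dual P L, h⟩
  have i2 (L M : StrongDual ℝ E) : HasExpectation P (fun x ↦ L x * M x) (∫ x, L x * M x ∂P) :=
    .of_integrable (integrable_dual_mul P L M)
  -- With `b, c, d` equal to `±1` these are the eight fourth powers of `polarization_four`. Each is
  -- the fourth power of a single centred functional, whose variance is expanded bilinearly.
  have key (b c d : ℝ) : HasExpectation P (fun x ↦ (A x + b * B x + c * C x + d * D x) ^ 4)
      (3 * ((∫ x, A x * A x ∂P) + b ^ 2 * (∫ x, B x * B x ∂P) +
        c ^ 2 * (∫ x, C x * C x ∂P) + d ^ 2 * (∫ x, D x * D x ∂P) +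
        2 * b * (∫ x, A x * B x ∂P) + 2 * c * (∫ x, A x * C x ∂P) +
        2 * d * (∫ x, A x * D x ∂P) + 2 * b * c * (∫ x, B x * C x ∂P) +
        2 * b * d * (∫ x, B x * D x ∂P) + 2 * c * d * (∫ x, C x * D x ∂P)) ^ 2) := by
    have e (x : E) : (A + b • B + c • C + d • D) x = A x + b * B x + c * C x + d * D x := by simp
    refine (hasExpectation_dual_pow_four P (L := A + b • B + c • C + d • D) ?_ ?_).congr
      (fun x ↦ by rw [e]) rfl
    · exact (((((i1 A hA).add ((i1 B hB).const_mul b)).add ((i1 C hC).const_mul c)).add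
        ((i1 D hD).const_mul d)).congr e (b := 0) (by ring)).2
    · exact ((((((((((i2 A A).add ((i2 B B).const_mul (b ^ 2))).add
        ((i2 C C).const_mul (c ^ 2))).add ((i2 D D).const_mul (d ^ 2))).add
        ((i2 A B).const_mul (2 * b))).add ((i2 A C).const_mul (2 * c))).add
        ((i2 A D).const_mul (2 * d))).add ((i2 B C).const_mul (2 * b * c))).add
        ((i2 B D).const_mul (2 * b * d))).add ((i2 C D).const_mul (2 * c * d))).congr
        (fun x ↦ by rw [e]; ring) rfl
  refine ((((((((((key 1 1 1).sub (key 1 1 (-1))).sub (key 1 (-1) 1)).add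
    (key 1 (-1) (-1))).sub (key (-1) 1 1)).add (key (-1) 1 (-1))).add (key (-1) (-1) 1)).sub
    (key (-1) (-1) (-1))).const_mul (1 / 192))).congr (fun x ↦ ?_) (by ring)
  rw [polarization_four]
  ring

end Isserlis

end RecursiveGaussian

/-! ### Moments of the sample mean and sample covariance -/

namespace RecursiveGaussian

variable {p N : ℕ}

/-- Joint Gaussianity of the whole dataset lets Isserlis' theorem act directly on the deviations
from the sample mean, which mix all the points and are not independent. -/
lemma isGaussian_pi (ν : EuclideanSpace ℝ (Fin p)) (T : Matrix (Fin p) (Fin p) ℝ) :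
    IsGaussian (Measure.pi fun _ : Fin N ↦ multivariateGaussian ν T) := by
  have hind : iIndepFun (fun (i : Fin N) (ω : Dataset p N) ↦ ω i)
      (Measure.pi fun _ : Fin N ↦ multivariateGaussian ν T) :=
    iIndepFun_pi (X := fun _ ↦ id) fun _ ↦ aemeasurable_id
  have hlaw := iIndepFun.hasGaussianLaw (fun i ↦ ⟨by
    rw [(measurePreserving_eval _ i).map_eq]; infer_instance⟩) hind
  have := hlaw.isGaussian_map
  rwa [show (fun (ω : Dataset p N) (i : Fin N) ↦ ω i) = id from rfl, Measure.map_id] at this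

/-- The functional extracting coordinate `a` of the `i`-th data point. -/
noncomputable def coord (i : Fin N) (a : Fin p) : StrongDual ℝ (Dataset p N) :=
  (EuclideanSpace.proj a : StrongDual ℝ (EuclideanSpace ℝ (Fin p))).comp
    (ContinuousLinearMap.proj i)

@[simp] lemma coord_apply (i : Fin N) (a : Fin p) (x : Dataset p N) : coord i a x = x i a := rfl

/-- Coordinate `a` of the deviation of the `i`-th data point from the sample mean. -/
noncomputable def deviation (i : Fin N) (a : Fin p) : StrongDual ℝ (Dataset p N) :=
  coord i a - (1 / (N : ℝ)) • ∑ j, coord j a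

lemma sampleMean_apply (x : Dataset p N) (a : Fin p) :
    sampleMean x a = (1 / (N : ℝ)) * ∑ i, x i a := by
  simp [sampleMean]

lemma deviation_apply (i : Fin N) (a : Fin p) (x : Dataset p N) :
    deviation i a x = x i a - sampleMean x a := by
  simp [deviation, sampleMean_apply]

lemma sampleCov_apply (x : Dataset p N) (a b : Fin p) :
    sampleCov x a b = (1 / ((N : ℝ) - 1)) * ∑ i, deviation i a x * deviation i b x := by
  simp [sampleCov, Matrix.sum_apply, Matrix.vecMulVec_apply, deviation_apply]

lemma sampleMean_sub (hN : N ≠ 0) (x : Dataset p N) (ν : EuclideanSpace ℝ (Fin p)) (a : Fin p) :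
    sampleMean x a - ν a = (1 / (N : ℝ)) * ∑ i, (x i a - ν a) := by
  have : (N : ℝ) ≠ 0 := by exact_mod_cast hN
  rw [sampleMean_apply, Finset.sum_sub_distrib]
  simp
  field_simp

variable {ν : EuclideanSpace ℝ (Fin p)} {T : Matrix (Fin p) (Fin p) ℝ}

lemma hasExpectation_coord (i : Fin N) (a : Fin p) :
    HasExpectation (Measure.pi fun _ : Fin N ↦ multivariateGaussian ν T) (fun x ↦ x i a) (ν a) := by
  have := isGaussian_pi (N := N) ν T
  refine ⟨IsGaussian.integrable_dual _ (coord i a), ?_⟩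
  rw [integral_comp_eval (μ := fun _ : Fin N ↦ multivariateGaussian ν T) (i := i)
    (f := fun y : EuclideanSpace ℝ (Fin p) ↦ y a) (by fun_prop)]
  have h := IsGaussian.integral_dual (μ := multivariateGaussian ν T)
    (EuclideanSpace.proj a : StrongDual ℝ (EuclideanSpace ℝ (Fin p)))
  simpa using h

lemma hasExpectation_coord_sub (i : Fin N) (a : Fin p) :
    HasExpectation (Measure.pi fun _ : Fin N ↦ multivariateGaussian ν T)
      (fun x ↦ x i a - ν a) 0 :=
  ((hasExpectation_coord i a).sub (.const (ν a))).congr (fun _ ↦ rfl) (by simp)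

lemma hasExpectation_coord_mul (hT : T.PosSemidef) (i j : Fin N) (a b : Fin p) :
    HasExpectation (Measure.pi fun _ : Fin N ↦ multivariateGaussian ν T)
      (fun x ↦ (x i a - ν a) * (x j b - ν b)) (if i = j then T a b else 0) := by
  have := isGaussian_pi (N := N) ν T
  have hL (i : Fin N) (a : Fin p) : MemLp (fun x : Dataset p N ↦ x i a) 2
      (Measure.pi fun _ : Fin N ↦ multivariateGaussian ν T) :=
    IsGaussian.memLp_dual _ (coord i a) 2 (by simp)
  have hm (i : Fin N) (a : Fin p) := (hasExpectation_coord (ν := ν) (T := T) i a).2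
  have hcov : ∫ x, (x i a - ν a) * (x j b - ν b)
      ∂(Measure.pi fun _ : Fin N ↦ multivariateGaussian ν T) =
      cov[fun x : Dataset p N ↦ x i a, fun x ↦ x j b;
        Measure.pi fun _ : Fin N ↦ multivariateGaussian ν T] := by
    rw [covariance, hm, hm]
  refine ⟨((hL i a).sub (memLp_const (ν a))).integrable_mul
    ((hL j b).sub (memLp_const (ν b))), ?_⟩
  split_ifs with hij
  · subst hij
    rw [integral_comp_eval (μ := fun _ : Fin N ↦ multivariateGaussian ν T) (i := i)
      (f := fun y : EuclideanSpace ℝ (Fin p) ↦ (y a - ν a) * (y b - ν b)) (by fun_prop),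
      ← covariance_eval_multivariateGaussian (μ := ν) hT a b, covariance]
    have h (a : Fin p) := IsGaussian.integral_dual (μ := multivariateGaussian ν T)
      (EuclideanSpace.proj a : StrongDual ℝ (EuclideanSpace ℝ (Fin p)))
    simp only [PiLp.proj_apply, integral_id_multivariateGaussian] at h
    rw [h, h]
  · rw [hcov]
    have hind : iIndepFun (fun (i : Fin N) (ω : Dataset p N) ↦ ω i)
        (Measure.pi fun _ : Fin N ↦ multivariateGaussian ν T) :=
      iIndepFun_pi (X := fun _ ↦ id) fun _ ↦ aemeasurable_id
    have h2 := (hind.indepFun hij).comp (φ := fun y : EuclideanSpace ℝ (Fin p) ↦ y a)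
      (ψ := fun y : EuclideanSpace ℝ (Fin p) ↦ y b) (by fun_prop) (by fun_prop)
    exact h2.covariance_eq_zero (hL i a) (hL j b)

lemma hasExpectation_sampleMean (hN : N ≠ 0) (a : Fin p) :
    HasExpectation (Measure.pi fun _ : Fin N ↦ multivariateGaussian ν T)
      (fun x ↦ sampleMean x a - ν a) 0 :=
  ((HasExpectation.sum Finset.univ fun i _ ↦ hasExpectation_coord_sub i a).const_mul
    (1 / (N : ℝ))).congr (fun x ↦ sampleMean_sub hN x ν a) (by simp)

lemma hasExpectation_coord_mul_sampleMean (hT : T.PosSemidef) (hN : N ≠ 0) (i : Fin N)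
    (a b : Fin p) :
    HasExpectation (Measure.pi fun _ : Fin N ↦ multivariateGaussian ν T)
      (fun x ↦ (x i a - ν a) * (sampleMean x b - ν b)) (T a b / N) := by
  refine ((HasExpectation.sum Finset.univ fun j _ ↦
    hasExpectation_coord_mul hT i j a b).const_mul (1 / (N : ℝ))).congr (fun x ↦ ?_) ?_
  · rw [sampleMean_sub hN, Finset.mul_sum, Finset.mul_sum, Finset.mul_sum]
    exact Finset.sum_congr rfl fun j _ ↦ by ring
  · simp; ring

lemma hasExpectation_sampleMean_mul (hT : T.PosSemidef) (hN : N ≠ 0) (a b : Fin p) :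
    HasExpectation (Measure.pi fun _ : Fin N ↦ multivariateGaussian ν T)
      (fun x ↦ (sampleMean x a - ν a) * (sampleMean x b - ν b)) (T a b / N) := by
  have : (N : ℝ) ≠ 0 := by exact_mod_cast hN
  refine ((HasExpectation.sum Finset.univ fun i _ ↦
    hasExpectation_coord_mul_sampleMean hT hN i a b).const_mul (1 / (N : ℝ))).congr
    (fun x ↦ ?_) ?_
  · rw [sampleMean_sub hN x ν a, mul_assoc, Finset.sum_mul]
  · simp; field_simp

lemma hasExpectation_deviation (hN : N ≠ 0) (i : Fin N) (a : Fin p) :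
    HasExpectation (Measure.pi fun _ : Fin N ↦ multivariateGaussian ν T) (deviation i a) 0 :=
  ((hasExpectation_coord_sub i a).sub (hasExpectation_sampleMean hN a)).congr
    (fun x ↦ by rw [deviation_apply]; ring) (by simp)

/-- The deviations have covariance equal to the centering matrix `I - (1/N) J`, with `J` the
all-ones matrix, tensored with `T`. -/
lemma hasExpectation_deviation_mul (hT : T.PosSemidef) (hN : N ≠ 0) (i j : Fin N) (a b : Fin p) :
    HasExpectation (Measure.pi fun _ : Fin N ↦ multivariateGaussian ν T)
      (fun x ↦ deviation i a x * deviation j b x)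
      (((if i = j then 1 else 0) - 1 / (N : ℝ)) * T a b) := by
  refine ((((hasExpectation_coord_mul hT i j a b).sub
    (hasExpectation_coord_mul_sampleMean hT hN i a b)).sub
    (hasExpectation_coord_mul_sampleMean hT hN j b a)).add
    (hasExpectation_sampleMean_mul hT hN a b)).congr
    (fun x ↦ by rw [deviation_apply, deviation_apply]; ring) ?_
  rw [show T b a = T a b by simpa using hT.isHermitian.apply a b]
  split_ifs <;> ring

lemma hasExpectation_sampleCov (hT : T.PosSemidef) (hN : 2 ≤ N) (a b : Fin p) :
    HasExpectation (Measure.pi fun _ : Fin N ↦ multivariateGaussian ν T)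
      (fun x ↦ sampleCov x a b) (T a b) := by
  have h0 : (N : ℝ) ≠ 0 := by positivity
  have h1 : (N : ℝ) - 1 ≠ 0 := by
    have : (2 : ℝ) ≤ N := by exact_mod_cast hN
    linarith
  refine ((HasExpectation.sum Finset.univ fun i _ ↦
    hasExpectation_deviation_mul hT (by omega) i i a b).const_mul (1 / ((N : ℝ) - 1))).congr
    (fun x ↦ sampleCov_apply x a b) ?_
  simp
  field_simp

/-- The centering matrix is a symmetric projection, so the sum of squares along a row is its
diagonal entry. -/
lemma sum_centering_diag (hN : N ≠ 0) (i : Fin N) :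
    ∑ j : Fin N, ((if i = j then 1 else 0) - 1 / (N : ℝ)) ^ 2 = 1 - 1 / (N : ℝ) := by
  have h0 : (N : ℝ) ≠ 0 := by exact_mod_cast hN
  have (j : Fin N) : ((if i = j then 1 else 0) - 1 / (N : ℝ)) ^ 2 =
      (if i = j then 1 - 2 / (N : ℝ) else 0) + 1 / (N : ℝ) ^ 2 := by
    split_ifs <;> ring
  simp_rw [this]
  rw [Finset.sum_add_distrib]
  simp
  field_simp
  ring

/-- The pairing within each point contributes the squared trace `(N - 1)²` of the centering matrix.
Each of the two pairings across points contributes its squared Frobenius norm `N - 1`. -/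
lemma sum_isserlis (hN : N ≠ 0) (r₁ r₂ r₃ r₄ r₅ r₆ : ℝ) :
    ∑ i : Fin N, ∑ j : Fin N, ((1 - 1 / (N : ℝ)) * r₁ * ((1 - 1 / (N : ℝ)) * r₂) +
      ((if i = j then 1 else 0) - 1 / (N : ℝ)) * r₃ *
        (((if i = j then 1 else 0) - 1 / (N : ℝ)) * r₄) +
      ((if i = j then 1 else 0) - 1 / (N : ℝ)) * r₅ *
        (((if i = j then 1 else 0) - 1 / (N : ℝ)) * r₆)) =
      ((N : ℝ) - 1) ^ 2 * (r₁ * r₂) + ((N : ℝ) - 1) * (r₃ * r₄ + r₅ * r₆) := by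
  have h0 : (N : ℝ) ≠ 0 := by exact_mod_cast hN
  have e (i j : Fin N) : (1 - 1 / (N : ℝ)) * r₁ * ((1 - 1 / (N : ℝ)) * r₂) +
      ((if i = j then 1 else 0) - 1 / (N : ℝ)) * r₃ *
        (((if i = j then 1 else 0) - 1 / (N : ℝ)) * r₄) +
      ((if i = j then 1 else 0) - 1 / (N : ℝ)) * r₅ *
        (((if i = j then 1 else 0) - 1 / (N : ℝ)) * r₆) =
      (1 - 1 / (N : ℝ)) ^ 2 * (r₁ * r₂) +
        (r₃ * r₄ + r₅ * r₆) * ((if i = j then 1 else 0) - 1 / (N : ℝ)) ^ 2 := by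
    ring
  simp_rw [e, Finset.sum_add_distrib, ← Finset.mul_sum, sum_centering_diag hN]
  simp only [Finset.sum_const, Finset.card_univ, Fintype.card_fin, nsmul_eq_mul]
  field_simp

/-- This is the covariance structure of a Wishart matrix, obtained from Isserlis' theorem alone. The
pairing within points reproduces the product of the means and cancels after centring. -/
lemma hasExpectation_sampleCov_mul (hT : T.PosSemidef) (hN : 2 ≤ N) (a b c d : Fin p) :
    HasExpectation (Measure.pi fun _ : Fin N ↦ multivariateGaussian ν T)
      (fun x ↦ (sampleCov x a b - T a b) * (sampleCov x c d - T c d))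
      ((T a c * T b d + T a d * T b c) / ((N : ℝ) - 1)) := by
  have hN0 : N ≠ 0 := by omega
  have h0 : (N : ℝ) ≠ 0 := by exact_mod_cast hN0
  have h1 : (N : ℝ) - 1 ≠ 0 := by
    have : (2 : ℝ) ≤ N := by exact_mod_cast hN
    linarith
  have := isGaussian_pi (N := N) ν T
  have hm (i : Fin N) (a : Fin p) := (hasExpectation_deviation (ν := ν) (T := T) hN0 i a).2
  have hc (i j : Fin N) (a b : Fin p) := (hasExpectation_deviation_mul (ν := ν) hT hN0 i j a b).2
  have h4 (i j : Fin N) := hasExpectation_dual_mul_four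
    (Measure.pi fun _ : Fin N ↦ multivariateGaussian ν T) (hm i a) (hm i b) (hm j c) (hm j d)
  simp only [hc, if_true] at h4
  have h5 : HasExpectation (Measure.pi fun _ : Fin N ↦ multivariateGaussian ν T)
      (fun x ↦ sampleCov x a b * sampleCov x c d)
      (T a b * T c d + (T a c * T b d + T a d * T b c) / ((N : ℝ) - 1)) := by
    refine ((HasExpectation.sum Finset.univ fun i _ ↦ HasExpectation.sum Finset.univ fun j _ ↦
      h4 i j).const_mul (1 / ((N : ℝ) - 1) ^ 2)).congr (fun x ↦ ?_) ?_
    · rw [sampleCov_apply, sampleCov_apply, mul_mul_mul_comm, Finset.sum_mul_sum]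
      congr 1
      field_simp
    · rw [sum_isserlis hN0]
      field_simp
  exact (((h5.sub ((hasExpectation_sampleCov hT hN a b).const_mul (T c d))).sub
    ((hasExpectation_sampleCov hT hN c d).const_mul (T a b))).add
    (.const (T a b * T c d))).congr (fun x ↦ by ring) (by ring)

/-- The moment formulas for the synthetic sample require the current covariance matrix to be
positive semidefinite, so this property has to be carried along the recursion. -/
lemma posSemidef_sampleCov (hN : 2 ≤ N) (x : Dataset p N) : (sampleCov x).PosSemidef := by
  have : (2 : ℝ) ≤ N := by exact_mod_cast hN
  refine Matrix.PosSemidef.smul (Matrix.posSemidef_sum _ fun i _ ↦ ?_) ?_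
  · simpa using Matrix.posSemidef_vecMulVec_self_star (x i - sampleMean x).ofLp
  · exact one_div_nonneg.2 (by linarith)

end RecursiveGaussian

/-! ### The moment recursion of one training step -/

namespace RecursiveGaussian

lemma HasExpectation.bind {α β : Type*} [MeasurableSpace α] [MeasurableSpace β] {P : Measure α}
    [SFinite P] {κ : Kernel α β} [IsSFiniteKernel κ] {g : β → ℝ} {h : α → ℝ} {c : ℝ}
    (hint : Integrable g (P.bind κ))
    (hκ : ∀ᵐ x ∂P, ∫ y, g y ∂(κ x) = h x) (hP : HasExpectation P h c) :
    HasExpectation (P.bind κ) g c := by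
  refine ⟨hint, ?_⟩
  rw [← hP.2, ← integral_congr_ae hκ, Measure.comp_eq_comp_const_apply, Kernel.integral_comp,
    Kernel.const_apply]
  rwa [← Measure.comp_eq_comp_const_apply]

/-- For a nonnegative function, integrability under the composed law follows from integrability of
the conditional expectations, as in Tonelli's theorem. -/
lemma HasExpectation.bind_of_nonneg {α β : Type*} [MeasurableSpace α] [MeasurableSpace β]
    {P : Measure α} [SFinite P] {κ : Kernel α β} [IsSFiniteKernel κ] {g : β → ℝ} {h : α → ℝ}
    {c : ℝ} (hg : Measurable g) (h0 : ∀ y, 0 ≤ g y)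
    (hκ : ∀ᵐ x ∂P, HasExpectation (κ x) g (h x)) (hP : HasExpectation P h c) :
    HasExpectation (P.bind κ) g c := by
  refine .bind ?_ (hκ.mono fun x hx ↦ hx.2) hP
  refine (Measure.integrable_comp_iff hg.aestronglyMeasurable).2
    ⟨hκ.mono fun x hx ↦ hx.1, hP.1.congr (hκ.mono fun x hx ↦ ?_)⟩
  simp only [Real.norm_of_nonneg (h0 _)]
  exact hx.2.symm

/-- Second moments of a weighted combination of two independent centred families, the second one
shifted by a constant. -/
lemma hasExpectation_prod_weighted {α β : Type*} [MeasurableSpace α] [MeasurableSpace β]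
    {P : Measure α} {Q : Measure β} [IsProbabilityMeasure P] [IsProbabilityMeasure Q]
    {f g : α → ℝ} {f' g' : β → ℝ} {c c' : ℝ} (w r s : ℝ)
    (hf : HasExpectation P f 0) (hg : HasExpectation P g 0)
    (hfg : HasExpectation P (fun x ↦ f x * g x) c)
    (hf' : HasExpectation Q f' 0) (hg' : HasExpectation Q g' 0)
    (hfg' : HasExpectation Q (fun x ↦ f' x * g' x) c') :
    HasExpectation (P.prod Q)
      (fun z ↦ (w * f z.1 + (1 - w) * (f' z.2 + r)) * (w * g z.1 + (1 - w) * (g' z.2 + s)))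
      (w ^ 2 * c + (1 - w) ^ 2 * (c' + r * s)) := by
  -- Inserting constant factors `1` makes each nonconstant term of the expanded product a function
  -- of the first variable times a function of the second.
  have h1 : HasExpectation P (fun _ ↦ (1 : ℝ)) 1 := .const 1
  have h2 : HasExpectation Q (fun _ ↦ (1 : ℝ)) 1 := .const 1
  exact hfg.prod_mul h2 |>.const_mul (w ^ 2)
    |>.add ((hf.prod_mul hg').const_mul (w * (1 - w)))
    |>.add ((hf.prod_mul h2).const_mul (w * (1 - w) * s))
    |>.add ((hg.prod_mul hf').const_mul (w * (1 - w)))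
    |>.add ((hg.prod_mul h2).const_mul (w * (1 - w) * r))
    |>.add ((h1.prod_mul hfg').const_mul ((1 - w) ^ 2))
    |>.add ((h1.prod_mul hf').const_mul ((1 - w) ^ 2 * s))
    |>.add ((h1.prod_mul hg').const_mul ((1 - w) ^ 2 * r))
    |>.add (.const ((1 - w) ^ 2 * (r * s)))
    |>.congr (fun z ↦ by ring) (by ring)

section Moments

variable {p : ℕ}

/-- The squared distance of the mean vector from `μ`. -/
def sqErrMean (μ : EuclideanSpace ℝ (Fin p)) (η : Params p) : ℝ := ∑ a, (η.1 a - μ a) ^ 2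

/-- The squared Frobenius distance of the covariance matrix from `S`. -/
def sqErrCov (S : Matrix (Fin p) (Fin p) ℝ) (η : Params p) : ℝ := ∑ a, ∑ b, (η.2 a b - S a b) ^ 2

/-- The squared error of the trace of the covariance matrix. -/
def sqErrTrace (S : Matrix (Fin p) (Fin p) ℝ) (η : Params p) : ℝ := (∑ a, (η.2 a a - S a a)) ^ 2

/-- The sum of the squares of the entries. -/
def sumSq (S : Matrix (Fin p) (Fin p) ℝ) : ℝ := ∑ a, ∑ b, S a b ^ 2

lemma measurable_entry (a b : Fin p) : Measurable fun η : Params p ↦ η.2 a b :=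
  (measurable_pi_apply b).comp ((measurable_pi_apply a).comp measurable_snd)

lemma measurable_sqErrMean (μ : EuclideanSpace ℝ (Fin p)) : Measurable (sqErrMean μ) := by
  unfold sqErrMean
  fun_prop

lemma measurable_sqErrCov (S : Matrix (Fin p) (Fin p) ℝ) : Measurable (sqErrCov S) :=
  Finset.measurable_sum _ fun a _ ↦ Finset.measurable_sum _ fun b _ ↦
    ((measurable_entry a b).sub_const _).pow_const 2

lemma measurable_sqErrTrace (S : Matrix (Fin p) (Fin p) ℝ) : Measurable (sqErrTrace S) :=
  (Finset.measurable_sum _ fun a _ ↦ (measurable_entry a a).sub_const _).pow_const 2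

/-- The moments of a law of parameters that are propagated by the training recursion: the
covariance matrix is unbiased, and `a`, `u`, `v` are the mean squared errors of the mean, of the
covariance matrix and of its trace. -/
structure HasMoments (μ : EuclideanSpace ℝ (Fin p)) (S : Matrix (Fin p) (Fin p) ℝ)
    (P : Measure (Params p)) (a u v : ℝ) : Prop where
  posSemidef : ∀ᵐ η ∂P, η.2.PosSemidef
  cov (i j : Fin p) : HasExpectation P (fun η ↦ η.2 i j) (S i j)
  errMean : HasExpectation P (sqErrMean μ) a
  errCov : HasExpectation P (sqErrCov S) u
  errTrace : HasExpectation P (sqErrTrace S) v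

lemma measurableSet_posSemidef : MeasurableSet {η : Params p | η.2.PosSemidef} := by
  have h := (isClosed_nonneg p).measurableSet
  have : {η : Params p | η.2.PosSemidef} = Prod.snd ⁻¹' {T | T.PosSemidef} := rfl
  rw [this]
  refine measurable_snd ?_
  convert h using 2
  ext T
  exact Matrix.nonneg_iff_posSemidef.symm

lemma sum_trace_mul {S : Matrix (Fin p) (Fin p) ℝ} (hS : S.PosSemidef) :
    ∑ a, ∑ b, (S a a * S b b + S a b * S b a) = S.trace ^ 2 + sumSq S := by
  have h (a b : Fin p) : S b a = S a b := by simpa using hS.isHermitian.apply a b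
  simp only [Finset.sum_add_distrib, h, sumSq, sq, Matrix.trace, Matrix.diag_apply,
    Finset.sum_mul_sum]

lemma sum_sq_mul (S : Matrix (Fin p) (Fin p) ℝ) :
    ∑ a, ∑ b, (S a b * S a b + S a b * S a b) = 2 * sumSq S := by
  simp only [sumSq, Finset.mul_sum]
  exact Finset.sum_congr rfl fun a _ ↦ Finset.sum_congr rfl fun b _ ↦ by ring

lemma sqErrTrace_eq (S : Matrix (Fin p) (Fin p) ℝ) (η : Params p) :
    sqErrTrace S η = ∑ a, ∑ b, (η.2 a a - S a a) * (η.2 b b - S b b) := by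
  rw [sqErrTrace, sq, Finset.sum_mul_sum]

variable {μ : EuclideanSpace ℝ (Fin p)} {S : Matrix (Fin p) (Fin p) ℝ} {n m : ℕ} {w : ℝ}

lemma hasMoments_paramLaw_zero (hS : S.PosSemidef) (hn : 2 ≤ n) :
    HasMoments μ S (paramLaw (μ, S) n m w 0) (S.trace / n)
      ((sumSq S + S.trace ^ 2) / ((n : ℝ) - 1)) (2 * sumSq S / ((n : ℝ) - 1)) := by
  have hn0 : n ≠ 0 := by omega
  have hmap {g : Params p → ℝ} {c : ℝ} (hg : Measurable g)
      (h : HasExpectation (Measure.pi fun _ : Fin n ↦ multivariateGaussian μ S)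
        (fun x ↦ g (fit x)) c) : HasExpectation (paramLaw (μ, S) n m w 0) g c :=
    HasExpectation.map measurable_fit hg h
  refine ⟨?_, fun i j ↦ ?_, ?_, ?_, ?_⟩
  · exact (ae_map_iff measurable_fit.aemeasurable measurableSet_posSemidef).2
      (.of_forall fun x ↦ posSemidef_sampleCov hn x)
  · exact hmap (measurable_entry i j) (hasExpectation_sampleCov hS hn i j)
  · refine hmap (measurable_sqErrMean μ) ((HasExpectation.sum Finset.univ fun a _ ↦
      hasExpectation_sampleMean_mul (ν := μ) hS hn0 a a).congr (fun x ↦ ?_) ?_)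
    · simp only [sqErrMean, sq]; rfl
    · rw [← Finset.sum_div]; rfl
  · refine hmap (measurable_sqErrCov S) ((HasExpectation.sum Finset.univ fun a _ ↦
      HasExpectation.sum Finset.univ fun b _ ↦
      hasExpectation_sampleCov_mul (ν := μ) hS hn a b a b).congr (fun x ↦ ?_) ?_)
    · simp only [sqErrCov, sq]; rfl
    · simp only [← Finset.sum_div, sum_trace_mul hS, add_comm]
  · refine hmap (measurable_sqErrTrace S) ((HasExpectation.sum Finset.univ fun a _ ↦
      HasExpectation.sum Finset.univ fun b _ ↦
      hasExpectation_sampleCov_mul (ν := μ) hS hn a a b b).congr (fun x ↦ ?_) ?_)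
    · rw [sqErrTrace_eq]; rfl
    · simp only [← Finset.sum_div, sum_sq_mul]

lemma hasExpectation_step {θ θ' : Params p} {g : Params p → ℝ} {c : ℝ} (hg : Measurable g)
    (h : HasExpectation ((Measure.pi fun _ : Fin n ↦ multivariateGaussian θ.1 θ.2).prod
      (Measure.pi fun _ : Fin m ↦ multivariateGaussian θ'.1 θ'.2))
      (fun d ↦ g (weightedFit w d)) c) : HasExpectation (step θ n m w θ') g c := by
  rw [step, Kernel.map_apply _ (measurable_weightedFit w), Kernel.prod_apply, Kernel.const_apply]
  exact HasExpectation.map (measurable_weightedFit w) hg h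

/-- The three summands are real noise, synthetic noise and inherited error once `ν` is the current
mean. -/
lemma weightedFit_mean_sub (d : Dataset p n × Dataset p m) (ν : EuclideanSpace ℝ (Fin p))
    (a : Fin p) :
    (weightedFit w d).1 a - μ a = w * (sampleMean d.1 a - μ a) +
      (1 - w) * ((sampleMean d.2 a - ν a) + (ν a - μ a)) := by
  simp [weightedFit]
  ring

lemma weightedFit_cov_sub (d : Dataset p n × Dataset p m) (T : Matrix (Fin p) (Fin p) ℝ)
    (a b : Fin p) :
    (weightedFit w d).2 a b - S a b = w * (sampleCov d.1 a b - S a b) +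
      (1 - w) * ((sampleCov d.2 a b - T a b) + (T a b - S a b)) := by
  simp [weightedFit]
  ring

lemma hasExpectation_step_mean (hS : S.PosSemidef) (hn : 2 ≤ n) (hm : 2 ≤ m) {θ : Params p}
    (hθ : θ.2.PosSemidef) :
    HasExpectation (step (μ, S) n m w θ) (sqErrMean μ)
      (w ^ 2 * (S.trace / n) + (1 - w) ^ 2 * (θ.2.trace / m + sqErrMean μ θ)) := by
  have hn0 : n ≠ 0 := by omega
  have hm0 : m ≠ 0 := by omega
  refine hasExpectation_step (measurable_sqErrMean μ) ((HasExpectation.sum Finset.univ fun a _ ↦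
    hasExpectation_prod_weighted w (θ.1 a - μ a) (θ.1 a - μ a)
      (hasExpectation_sampleMean hn0 a) (hasExpectation_sampleMean hn0 a)
      (hasExpectation_sampleMean_mul hS hn0 a a)
      (hasExpectation_sampleMean hm0 a) (hasExpectation_sampleMean hm0 a)
      (hasExpectation_sampleMean_mul hθ hm0 a a)).congr (fun d ↦ ?_) ?_)
  · simp only [sqErrMean, weightedFit_mean_sub d θ.1, sq]
  · simp only [Finset.sum_add_distrib, ← Finset.mul_sum, ← Finset.sum_div, sqErrMean, sq]
    rfl

/-- A common source for two recursions: summing over the index pattern `a b a b` gives the Frobenius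
error, and over `a a b b` the trace error. -/
lemma hasExpectation_step_entry (hS : S.PosSemidef) (hn : 2 ≤ n) (hm : 2 ≤ m) {θ : Params p}
    (hθ : θ.2.PosSemidef) (a b c d : Fin p) :
    HasExpectation ((Measure.pi fun _ : Fin n ↦ multivariateGaussian μ S).prod
      (Measure.pi fun _ : Fin m ↦ multivariateGaussian θ.1 θ.2))
      (fun z ↦ ((weightedFit w z).2 a b - S a b) * ((weightedFit w z).2 c d - S c d))
      (w ^ 2 * ((S a c * S b d + S a d * S b c) / ((n : ℝ) - 1)) +
        (1 - w) ^ 2 * ((θ.2 a c * θ.2 b d + θ.2 a d * θ.2 b c) / ((m : ℝ) - 1) +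
          (θ.2 a b - S a b) * (θ.2 c d - S c d))) := by
  have hc {N : ℕ} (hN : 2 ≤ N) {ν : EuclideanSpace ℝ (Fin p)} {T : Matrix (Fin p) (Fin p) ℝ}
      (hT : T.PosSemidef) (a b : Fin p) :
      HasExpectation (Measure.pi fun _ : Fin N ↦ multivariateGaussian ν T)
        (fun x ↦ sampleCov x a b - T a b) 0 :=
    ((hasExpectation_sampleCov hT hN a b).sub (.const (T a b))).congr (fun _ ↦ rfl) (by ring)
  exact (hasExpectation_prod_weighted w (θ.2 a b - S a b) (θ.2 c d - S c d)
    (hc hn hS a b) (hc hn hS c d) (hasExpectation_sampleCov_mul hS hn a b c d)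
    (hc hm hθ a b) (hc hm hθ c d) (hasExpectation_sampleCov_mul hθ hm a b c d)).congr
    (fun z ↦ by rw [weightedFit_cov_sub z θ.2, weightedFit_cov_sub z θ.2]) rfl

lemma hasExpectation_step_cov (hS : S.PosSemidef) (hn : 2 ≤ n) (hm : 2 ≤ m) {θ : Params p}
    (hθ : θ.2.PosSemidef) :
    HasExpectation (step (μ, S) n m w θ) (sqErrCov S)
      (w ^ 2 * ((S.trace ^ 2 + sumSq S) / ((n : ℝ) - 1)) +
        (1 - w) ^ 2 * ((θ.2.trace ^ 2 + sumSq θ.2) / ((m : ℝ) - 1) + sqErrCov S θ)) := by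
  refine hasExpectation_step (measurable_sqErrCov S) ((HasExpectation.sum Finset.univ fun a _ ↦
    HasExpectation.sum Finset.univ fun b _ ↦
      hasExpectation_step_entry (w := w) hS hn hm hθ a b a b).congr (fun d ↦ ?_) ?_)
  · simp only [sqErrCov, sq]
  · rw [← sum_trace_mul hS, ← sum_trace_mul hθ]
    simp only [Finset.sum_add_distrib, ← Finset.mul_sum, ← Finset.sum_div, sqErrCov, sq]

lemma hasExpectation_step_trace (hS : S.PosSemidef) (hn : 2 ≤ n) (hm : 2 ≤ m) {θ : Params p}
    (hθ : θ.2.PosSemidef) :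
    HasExpectation (step (μ, S) n m w θ) (sqErrTrace S)
      (w ^ 2 * (2 * sumSq S / ((n : ℝ) - 1)) +
        (1 - w) ^ 2 * (2 * sumSq θ.2 / ((m : ℝ) - 1) + sqErrTrace S θ)) := by
  refine hasExpectation_step (measurable_sqErrTrace S) ((HasExpectation.sum Finset.univ fun a _ ↦
    HasExpectation.sum Finset.univ fun b _ ↦
      hasExpectation_step_entry (w := w) hS hn hm hθ a a b b).congr (fun d ↦ ?_) ?_)
  · rw [sqErrTrace_eq]
  · rw [← sum_sq_mul, ← sum_sq_mul, sqErrTrace_eq]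
    simp only [Finset.sum_add_distrib, ← Finset.mul_sum, ← Finset.sum_div]

lemma hasExpectation_step_mean_cov (hS : S.PosSemidef) (hn : 2 ≤ n) (hm : 2 ≤ m) {θ : Params p}
    (hθ : θ.2.PosSemidef) (a b : Fin p) :
    HasExpectation (step (μ, S) n m w θ) (fun η ↦ η.2 a b)
      (w * S a b + (1 - w) * θ.2 a b) := by
  refine hasExpectation_step (measurable_entry a b)
    (((((hasExpectation_sampleCov hS hn a b).prod_mul (.const 1)).const_mul w).add
    ((HasExpectation.prod_mul (.const 1) (hasExpectation_sampleCov hθ hm a b)).const_mul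
      (1 - w))).congr (fun z ↦ ?_) ?_)
  · simp [weightedFit]
  · ring

lemma posSemidef_step (hn : 2 ≤ n) (hm : 2 ≤ m) (hw : w ∈ Set.Icc (0 : ℝ) 1) (θ' θ : Params p) :
    ∀ᵐ η ∂(step θ' n m w θ), η.2.PosSemidef := by
  rw [step, Kernel.map_apply _ (measurable_weightedFit w)]
  refine (ae_map_iff (measurable_weightedFit w).aemeasurable measurableSet_posSemidef).2
    (.of_forall fun d ↦ ?_)
  exact ((posSemidef_sampleCov hn d.1).smul hw.1).add
    ((posSemidef_sampleCov hm d.2).smul (sub_nonneg.2 hw.2))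

variable {P : Measure (Params p)} {a u v : ℝ}

lemma HasMoments.trace [IsProbabilityMeasure P] (h : HasMoments μ S P a u v) :
    HasExpectation P (fun η ↦ η.2.trace) S.trace :=
  .sum Finset.univ fun i _ ↦ h.cov i i

/-- Unbiasedness makes this the decomposition of a second moment into variance plus squared mean. It
expresses the synthetic noise through `v`, and `HasMoments.sumSq` does the same through `u`. -/
lemma HasMoments.trace_sq [IsProbabilityMeasure P] (h : HasMoments μ S P a u v) :
    HasExpectation P (fun η ↦ η.2.trace ^ 2) (v + S.trace ^ 2) := by
  refine ((h.errTrace.add (h.trace.const_mul (2 * S.trace))).sub (.const (S.trace ^ 2))).congr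
    (fun η ↦ ?_) (by ring)
  rw [sqErrTrace, Finset.sum_sub_distrib]
  simp only [Matrix.trace, Matrix.diag_apply]
  ring

lemma HasMoments.sumSq [IsProbabilityMeasure P] (h : HasMoments μ S P a u v) :
    HasExpectation P (fun η ↦ sumSq η.2) (u + sumSq S) := by
  refine ((h.errCov.add ((HasExpectation.sum Finset.univ fun i _ ↦ .sum Finset.univ fun j _ ↦
    (h.cov i j).const_mul (S i j)).const_mul 2)).sub (.const (RecursiveGaussian.sumSq S))).congr
    (fun η ↦ ?_) ?_
  · simp only [RecursiveGaussian.sumSq, sqErrCov, Finset.mul_sum, ← Finset.sum_add_distrib,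
      ← Finset.sum_sub_distrib]
    exact Finset.sum_congr rfl fun a _ ↦ Finset.sum_congr rfl fun b _ ↦ by ring
  · simp only [RecursiveGaussian.sumSq, ← sq]
    ring

lemma HasMoments.step [IsProbabilityMeasure P] (h : HasMoments μ S P a u v) (hS : S.PosSemidef)
    (hn : 2 ≤ n) (hm : 2 ≤ m) (hw : w ∈ Set.Icc (0 : ℝ) 1) :
    HasMoments μ S (P.bind (step (μ, S) n m w))
      (w ^ 2 * (S.trace / n) + (1 - w) ^ 2 * (S.trace / m + a))
      (w ^ 2 * ((S.trace ^ 2 + RecursiveGaussian.sumSq S) / ((n : ℝ) - 1)) +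
        (1 - w) ^ 2 * ((S.trace ^ 2 + v + (RecursiveGaussian.sumSq S + u)) / ((m : ℝ) - 1) + u))
      (w ^ 2 * (2 * RecursiveGaussian.sumSq S / ((n : ℝ) - 1)) +
        (1 - w) ^ 2 * (2 * (RecursiveGaussian.sumSq S + u) / ((m : ℝ) - 1) + v)) := by
  -- The Frobenius error comes before the unbiasedness of the entries: an entry has no sign, and its
  -- integrability is deduced from `|x| ≤ (x - s)² + 1 + |s|`.
  have hcov : HasExpectation (P.bind (RecursiveGaussian.step (μ, S) n m w)) (sqErrCov S) _ :=
    .bind_of_nonneg (measurable_sqErrCov S)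
      (fun η ↦ Finset.sum_nonneg fun _ _ ↦ Finset.sum_nonneg fun _ _ ↦ sq_nonneg _)
      (h.posSemidef.mono fun θ hθ ↦ hasExpectation_step_cov hS hn hm hθ)
      ((HasExpectation.const _).add (((((h.trace_sq.add h.sumSq).const_mul
        (1 / ((m : ℝ) - 1))).congr (fun θ ↦ by ring) rfl).add h.errCov).const_mul _))
  refine ⟨?_, fun i j ↦ ?_, ?_, ?_, ?_⟩
  · exact Measure.ae_comp_of_ae_ae measurableSet_posSemidef
      (.of_forall fun θ ↦ posSemidef_step hn hm hw _ θ)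
  · refine .bind ?_
      (h.posSemidef.mono fun θ hθ ↦ (hasExpectation_step_mean_cov hS hn hm hθ i j).2)
      (((HasExpectation.const (w * S i j)).add ((h.cov i j).const_mul (1 - w))).congr
        (fun _ ↦ rfl) (by ring))
    refine (((hcov.1.add (integrable_const (1 + |S i j|)))).mono'
      (measurable_entry i j).aestronglyMeasurable (.of_forall fun η ↦ ?_))
    have h1 : (η.2 i j - S i j) ^ 2 ≤ sqErrCov S η :=
      (Finset.single_le_sum (f := fun b ↦ (η.2 i b - S i b) ^ 2) (fun _ _ ↦ sq_nonneg _)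
        (Finset.mem_univ j)).trans (Finset.single_le_sum
          (f := fun a ↦ ∑ b, (η.2 a b - S a b) ^ 2)
          (fun _ _ ↦ Finset.sum_nonneg fun _ _ ↦ sq_nonneg _) (Finset.mem_univ i))
    have h2 : |η.2 i j| ≤ |η.2 i j - S i j| + |S i j| := by
      simpa using abs_add_le (η.2 i j - S i j) (S i j)
    have h3 : |η.2 i j - S i j| ≤ (η.2 i j - S i j) ^ 2 + 1 := by
      nlinarith [sq_abs (η.2 i j - S i j), sq_nonneg (|η.2 i j - S i j| - 1),
        abs_nonneg (η.2 i j - S i j)]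
    rw [Real.norm_eq_abs, Pi.add_apply]
    linarith
  · exact .bind_of_nonneg (measurable_sqErrMean μ)
      (fun η ↦ Finset.sum_nonneg fun _ _ ↦ sq_nonneg _)
      (h.posSemidef.mono fun θ hθ ↦ hasExpectation_step_mean hS hn hm hθ)
      (((HasExpectation.const (w ^ 2 * (S.trace / n))).add (((h.trace.const_mul (1 / (m : ℝ))).add
        h.errMean).const_mul ((1 - w) ^ 2))).congr (fun θ ↦ by ring) (by ring))
  · exact hcov.congr (fun _ ↦ rfl) (by ring)
  · exact .bind_of_nonneg (measurable_sqErrTrace S) (fun η ↦ sq_nonneg _)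
      (h.posSemidef.mono fun θ hθ ↦ hasExpectation_step_trace hS hn hm hθ)
      (((HasExpectation.const
        (w ^ 2 * (2 * RecursiveGaussian.sumSq S / ((n : ℝ) - 1)))).add (((h.sumSq.const_mul (2 / ((m : ℝ) - 1))).add
        h.errTrace).const_mul ((1 - w) ^ 2))).congr (fun θ ↦ by ring) (by ring))

end Moments

end RecursiveGaussian

/-! ### Solving the recursions and taking the limit in time -/

namespace RecursiveGaussian

/-- The orbit of `x` under the affine map `y ↦ α + β * y`. -/
def affineOrbit (x α β : ℝ) : ℕ → ℝ
  | 0 => x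
  | t + 1 => α + β * affineOrbit x α β t

lemma tendsto_affineOrbit {x α β : ℝ} (h0 : 0 ≤ β) (h1 : β < 1) :
    Tendsto (affineOrbit x α β) atTop (𝓝 (α / (1 - β))) := by
  have hβ : 1 - β ≠ 0 := by linarith
  have h (t : ℕ) : affineOrbit x α β t = α / (1 - β) + β ^ t * (x - α / (1 - β)) := by
    induction t with
    | zero => simp [affineOrbit]
    | succ t ih => rw [affineOrbit, ih]; field_simp; ring
  have := ((tendsto_pow_atTop_nhds_zero_of_lt_one h0 h1).mul_const
    (x - α / (1 - β))).const_add (α / (1 - β))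
  simpa [funext h] using this

/-- Each step adds at least `α`, so the orbit grows at least linearly, even at the critical ratio `β
= 1`. -/
lemma tendsto_affineOrbit_atTop {x α β : ℝ} (hx : 0 ≤ x) (hα : 0 < α) (hβ : 1 ≤ β) :
    Tendsto (affineOrbit x α β) atTop atTop := by
  have h (t : ℕ) : t * α ≤ affineOrbit x α β t := by
    induction t with
    | zero => simpa [affineOrbit] using hx
    | succ t ih =>
      have : 0 ≤ t * α := by positivity
      rw [affineOrbit]
      push_cast
      nlinarith
  exact tendsto_atTop_mono h (tendsto_natCast_atTop_atTop.atTop_mul_const hα)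

variable {p : ℕ} {μ : EuclideanSpace ℝ (Fin p)} {S : Matrix (Fin p) (Fin p) ℝ} {n m : ℕ} {w : ℝ}

lemma trace_sq_eq_sumSq (hS : S.PosSemidef) : (S ^ 2).trace = sumSq S := by
  have h (a b : Fin p) : S b a = S a b := by simpa using hS.isHermitian.apply a b
  simp [sq, Matrix.trace, Matrix.mul_apply, sumSq, h]

lemma sumSq_nonneg (S : Matrix (Fin p) (Fin p) ℝ) : 0 ≤ sumSq S :=
  Finset.sum_nonneg fun _ _ ↦ Finset.sum_nonneg fun _ _ ↦ sq_nonneg _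

lemma trace_pos (hS : S.PosSemidef) (hS0 : S ≠ 0) : 0 < S.trace :=
  lt_of_le_of_ne hS.trace_nonneg fun h ↦ hS0 (hS.trace_eq_zero_iff.1 h.symm)

/-- The forcing factor `w² / (n - 1) + (1 - w)² / (m - 1)` of the covariance recursion. -/
noncomputable def covForcing (n m : ℕ) (w : ℝ) : ℝ :=
  w ^ 2 / ((n : ℝ) - 1) + (1 - w) ^ 2 / ((m : ℝ) - 1)

/-- The mean squared error of the mean after `t` steps. -/
noncomputable def meanOrbit (S : Matrix (Fin p) (Fin p) ℝ) (n m : ℕ) (w : ℝ) : ℕ → ℝ :=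
  affineOrbit (S.trace / n) (w ^ 2 * (S.trace / n) + (1 - w) ^ 2 * (S.trace / m)) ((1 - w) ^ 2)

/-- The combination `2 u + v` of the errors `u` of the covariance and `v` of its trace. -/
noncomputable def upperOrbit (S : Matrix (Fin p) (Fin p) ℝ) (n m : ℕ) (w : ℝ) : ℕ → ℝ :=
  affineOrbit ((4 * sumSq S + 2 * S.trace ^ 2) / ((n : ℝ) - 1))
    (covForcing n m w * (4 * sumSq S + 2 * S.trace ^ 2)) ((1 - w) ^ 2 * (1 + 2 / ((m : ℝ) - 1)))

/-- The combination `u - v` of the errors `u` of the covariance and `v` of its trace. -/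
noncomputable def lowerOrbit (S : Matrix (Fin p) (Fin p) ℝ) (n m : ℕ) (w : ℝ) : ℕ → ℝ :=
  affineOrbit ((S.trace ^ 2 - sumSq S) / ((n : ℝ) - 1))
    (covForcing n m w * (S.trace ^ 2 - sumSq S)) ((1 - w) ^ 2 * (1 - 1 / ((m : ℝ) - 1)))

lemma HasMoments.congr {P : Measure (Params p)} {a u v a' u' v' : ℝ} (h : HasMoments μ S P a u v)
    (ha : a' = a) (hu : u' = u) (hv : v' = v) : HasMoments μ S P a' u' v' := by
  rwa [ha, hu, hv]

/-- With `ε = 1/(m-1)`, the pair `(u, v)` evolves by `(1 - w)²` times the matrix with rows `(1 + ε,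
ε)` and `(2ε, 1)`, plus a constant. Its left eigenvectors `(2, 1)` and `(1, -1)` have eigenvalues `1
+ 2ε` and `1 - ε` before that factor, which decouples the system. -/
lemma hasMoments_paramLaw (hS : S.PosSemidef) (hn : 2 ≤ n) (hm : 2 ≤ m)
    (hw : w ∈ Set.Icc (0 : ℝ) 1) (t : ℕ) :
    HasMoments μ S (paramLaw (μ, S) n m w t) (meanOrbit S n m w t)
      ((upperOrbit S n m w t + lowerOrbit S n m w t) / 3)
      ((upperOrbit S n m w t - 2 * lowerOrbit S n m w t) / 3) := by
  induction t with
  | zero =>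
    refine (hasMoments_paramLaw_zero hS hn).congr rfl ?_ ?_
    · simp only [upperOrbit, lowerOrbit, affineOrbit]; ring
    · simp only [upperOrbit, lowerOrbit, affineOrbit]; ring
  | succ t ih =>
    refine (ih.step hS hn hm hw).congr ?_ ?_ ?_
    · simp only [meanOrbit, affineOrbit]; ring
    · simp only [upperOrbit, lowerOrbit, affineOrbit, covForcing]; ring
    · simp only [upperOrbit, lowerOrbit, affineOrbit, covForcing]; ring

lemma errMean_eq (hS : S.PosSemidef) (hn : 2 ≤ n) (hm : 2 ≤ m) (hw : w ∈ Set.Icc (0 : ℝ) 1) :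
    errMean (μ, S) n m w = fun t ↦ ENNReal.ofReal (meanOrbit S n m w t) := by
  funext t
  rw [← (hasMoments_paramLaw (μ := μ) hS hn hm hw t).errMean.lintegral_ofReal
    fun η ↦ Finset.sum_nonneg fun _ _ ↦ sq_nonneg _]
  simp only [errMean, EuclideanSpace.real_norm_sq_eq, sqErrMean, PiLp.sub_apply]

lemma errCov_eq (hS : S.PosSemidef) (hn : 2 ≤ n) (hm : 2 ≤ m) (hw : w ∈ Set.Icc (0 : ℝ) 1) :
    errCov (μ, S) n m w =
      fun t ↦ ENNReal.ofReal ((upperOrbit S n m w t + lowerOrbit S n m w t) / 3) := by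
  funext t
  rw [← (hasMoments_paramLaw (μ := μ) hS hn hm hw t).errCov.lintegral_ofReal
    fun η ↦ Finset.sum_nonneg fun _ _ ↦ Finset.sum_nonneg fun _ _ ↦ sq_nonneg _]
  rfl

lemma tendsto_errMean (hS : S.PosSemidef) (hn : 2 ≤ n) (hm : 2 ≤ m)
    (hw : w ∈ Set.Ioc (0 : ℝ) 1) :
    Tendsto (errMean (μ, S) n m w) atTop
      (𝓝 (ENNReal.ofReal (weightConst w ((n : ℝ) / m) * S.trace / n))) := by
  have hn0 : (n : ℝ) ≠ 0 := by positivity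
  have hm0 : (m : ℝ) ≠ 0 := by positivity
  rw [errMean_eq hS hn hm ⟨hw.1.le, hw.2⟩]
  refine (ENNReal.continuous_ofReal.tendsto _).comp ?_
  have h := tendsto_affineOrbit (x := S.trace / n)
    (α := w ^ 2 * (S.trace / n) + (1 - w) ^ 2 * (S.trace / m)) (sq_nonneg (1 - w))
    (by nlinarith [hw.1, hw.2])
  have hd : 2 * w - w ^ 2 ≠ 0 := by nlinarith [hw.1, hw.2]
  have e : weightConst w ((n : ℝ) / m) * S.trace / n =
      (w ^ 2 * (S.trace / n) + (1 - w) ^ 2 * (S.trace / m)) / (1 - (1 - w) ^ 2) := by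
    rw [weightConst, show 1 - (1 - w) ^ 2 = 2 * w - w ^ 2 by ring]
    field_simp
  rw [e]
  exact h

lemma tendsto_errMean_zero (hS : S.PosSemidef) (hS0 : S ≠ 0) (hn : 2 ≤ n) (hm : 2 ≤ m) :
    Tendsto (errMean (μ, S) n m 0) atTop (𝓝 ⊤) := by
  have := trace_pos hS hS0
  rw [errMean_eq hS hn hm ⟨le_rfl, zero_le_one⟩]
  have hm' : (0 : ℝ) < m := by positivity
  exact ENNReal.tendsto_ofReal_atTop.comp
    (tendsto_affineOrbit_atTop (by positivity) (by norm_num; positivity) (by norm_num))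

/-- The limiting error of the covariance in the subcritical case. -/
noncomputable def covLimit (S : Matrix (Fin p) (Fin p) ℝ) (n m : ℕ) (w : ℝ) : ℝ :=
  (covForcing n m w * (4 * sumSq S + 2 * S.trace ^ 2) /
      (1 - (1 - w) ^ 2 * (1 + 2 / ((m : ℝ) - 1))) +
    covForcing n m w * (S.trace ^ 2 - sumSq S) /
      (1 - (1 - w) ^ 2 * (1 - 1 / ((m : ℝ) - 1)))) / 3

/-- The ratio lies in `[0, 1)` even at `w = 0`, because `0 < 1/(m-1) ≤ 1`. Hence only `upperOrbit`
can diverge. -/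
lemma tendsto_lowerOrbit (hm : 2 ≤ m) (hw : w ∈ Set.Icc (0 : ℝ) 1) :
    Tendsto (lowerOrbit S n m w) atTop (𝓝 (covForcing n m w * (S.trace ^ 2 - sumSq S) /
      (1 - (1 - w) ^ 2 * (1 - 1 / ((m : ℝ) - 1))))) := by
  have hm' : (2 : ℝ) ≤ m := by exact_mod_cast hm
  have h1 : 1 / ((m : ℝ) - 1) ≤ 1 := by rw [div_le_one (by linarith)]; linarith
  have h2 : 0 < 1 / ((m : ℝ) - 1) := one_div_pos.2 (by linarith)
  have h3 : (1 - w) ^ 2 ≤ 1 := by nlinarith [hw.1, hw.2]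
  exact tendsto_affineOrbit (mul_nonneg (sq_nonneg _) (by linarith))
    (by nlinarith [sq_nonneg (1 - w)])

lemma tendsto_errCov (hS : S.PosSemidef) (hn : 2 ≤ n) (hm : 2 ≤ m)
    (hw : w ∈ Set.Icc (0 : ℝ) 1) (h : (1 - w) ^ 2 * (1 + 2 / ((m : ℝ) - 1)) < 1) :
    Tendsto (errCov (μ, S) n m w) atTop (𝓝 (ENNReal.ofReal (covLimit S n m w))) := by
  have hm' : (2 : ℝ) ≤ m := by exact_mod_cast hm
  have h2 : 0 < 2 / ((m : ℝ) - 1) := div_pos two_pos (by linarith)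
  rw [errCov_eq hS hn hm hw]
  refine (ENNReal.continuous_ofReal.tendsto _).comp (Tendsto.div_const (Tendsto.add ?_ ?_) 3)
  · exact tendsto_affineOrbit (mul_nonneg (sq_nonneg _) (by linarith)) h
  · exact tendsto_lowerOrbit hm hw

lemma tendsto_errCov_top (hS : S.PosSemidef) (hS0 : S ≠ 0) (hn : 2 ≤ n) (hm : 2 ≤ m)
    (hw : w ∈ Set.Icc (0 : ℝ) 1) (h : 1 ≤ (1 - w) ^ 2 * (1 + 2 / ((m : ℝ) - 1))) :
    Tendsto (errCov (μ, S) n m w) atTop (𝓝 ⊤) := by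
  have := trace_pos hS hS0
  have hs := sumSq_nonneg S
  have hm' : (0 : ℝ) < (m : ℝ) - 1 := by
    have : (2 : ℝ) ≤ m := by exact_mod_cast hm
    linarith
  have hn' : (0 : ℝ) < (n : ℝ) - 1 := by
    have : (2 : ℝ) ≤ n := by exact_mod_cast hn
    linarith
  -- The supercritical hypothesis excludes `w = 1`, so the synthetic part alone makes the forcing
  -- positive.
  have hw1 : 0 < (1 - w) ^ 2 := by
    refine lt_of_le_of_ne (sq_nonneg _) fun h0 ↦ ?_
    rw [← h0] at h
    linarith
  rw [errCov_eq hS hn hm hw]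
  refine ENNReal.tendsto_ofReal_atTop.comp
    (Tendsto.atTop_div_const three_pos ((tendsto_affineOrbit_atTop (by positivity) ?_ h).atTop_add
      (tendsto_lowerOrbit hm hw)))
  unfold covForcing
  positivity

lemma errMeanLim_eq (hS : S.PosSemidef) (hn : 2 ≤ n) (hm : 2 ≤ m) (hw : w ∈ Set.Ioc (0 : ℝ) 1) :
    errMeanLim (μ, S) n m w = ENNReal.ofReal (weightConst w ((n : ℝ) / m) * S.trace / n) :=
  (tendsto_errMean hS hn hm hw).limsup_eq

lemma errMeanLim_zero (hS : S.PosSemidef) (hS0 : S ≠ 0) (hn : 2 ≤ n) (hm : 2 ≤ m) :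
    errMeanLim (μ, S) n m 0 = ⊤ :=
  (tendsto_errMean_zero hS hS0 hn hm).limsup_eq

lemma errCovLim_eq (hS : S.PosSemidef) (hn : 2 ≤ n) (hm : 2 ≤ m) (hw : w ∈ Set.Icc (0 : ℝ) 1)
    (h : (1 - w) ^ 2 * (1 + 2 / ((m : ℝ) - 1)) < 1) :
    errCovLim (μ, S) n m w = ENNReal.ofReal (covLimit S n m w) :=
  (tendsto_errCov hS hn hm hw h).limsup_eq

lemma errCovLim_eq_top (hS : S.PosSemidef) (hS0 : S ≠ 0) (hn : 2 ≤ n) (hm : 2 ≤ m)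
    (hw : w ∈ Set.Icc (0 : ℝ) 1) (h : 1 ≤ (1 - w) ^ 2 * (1 + 2 / ((m : ℝ) - 1))) :
    errCovLim (μ, S) n m w = ⊤ :=
  (tendsto_errCov_top hS hS0 hn hm hw h).limsup_eq

lemma errCovLim_one (hS : S.PosSemidef) (hn : 2 ≤ n) (hm : 2 ≤ m) :
    errCovLim (μ, S) n m 1 =
      ENNReal.ofReal (((S ^ 2).trace + S.trace ^ 2) / ((n : ℝ) - 1)) := by
  rw [errCovLim_eq hS hn hm ⟨zero_le_one, le_rfl⟩ (by norm_num), trace_sq_eq_sumSq hS]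
  congr 1
  simp only [covLimit, covForcing]
  ring

/-- The inequality is strict, so by continuity it persists for small positive `w`: there the
limiting covariance error is already infinite. -/
lemma one_lt_growth_zero (hm : 2 ≤ m) : 1 < (1 - (0 : ℝ)) ^ 2 * (1 + 2 / ((m : ℝ) - 1)) := by
  have hm' : (2 : ℝ) ≤ m := by exact_mod_cast hm
  have h2 : 0 < 2 / ((m : ℝ) - 1) := div_pos two_pos (by linarith)
  linarith

lemma tendsto_errMean_errMeanLim (hS : S.PosSemidef) (hS0 : S ≠ 0) (hn : 2 ≤ n) (hm : 2 ≤ m)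
    (hw : w ∈ Set.Icc (0 : ℝ) 1) :
    Tendsto (errMean (μ, S) n m w) atTop (𝓝 (errMeanLim (μ, S) n m w)) := by
  rcases hw.1.eq_or_lt with rfl | h0
  · rw [errMeanLim_zero hS hS0 hn hm]
    exact tendsto_errMean_zero hS hS0 hn hm
  · rw [errMeanLim_eq hS hn hm ⟨h0, hw.2⟩]
    exact tendsto_errMean hS hn hm ⟨h0, hw.2⟩

lemma tendsto_errCov_errCovLim (hS : S.PosSemidef) (hS0 : S ≠ 0) (hn : 2 ≤ n) (hm : 2 ≤ m)
    (hw : w ∈ Set.Icc (0 : ℝ) 1) :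
    Tendsto (errCov (μ, S) n m w) atTop (𝓝 (errCovLim (μ, S) n m w)) := by
  rcases lt_or_ge ((1 - w) ^ 2 * (1 + 2 / ((m : ℝ) - 1))) 1 with h | h
  · rw [errCovLim_eq hS hn hm hw h]
    exact tendsto_errCov hS hn hm hw h
  · rw [errCovLim_eq_top hS hS0 hn hm hw h]
    exact tendsto_errCov_top hS hS0 hn hm hw h

lemma tendsto_weightConst_zero {k : ℝ} (hk : 0 < k) :
    Tendsto (fun w ↦ weightConst w k) (𝓝[>] 0) atTop := by
  have h1 : Tendsto (fun w : ℝ ↦ w ^ 2 + (1 - w) ^ 2 * k) (𝓝[>] 0) (𝓝 k) := by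
    have : Continuous fun w : ℝ ↦ w ^ 2 + (1 - w) ^ 2 * k := by fun_prop
    simpa using (this.tendsto 0).mono_left nhdsWithin_le_nhds
  have h2 : Tendsto (fun w : ℝ ↦ 2 * w - w ^ 2) (𝓝[>] 0) (𝓝[>] 0) := by
    refine tendsto_nhdsWithin_iff.2 ⟨?_, ?_⟩
    · have : Continuous fun w : ℝ ↦ 2 * w - w ^ 2 := by fun_prop
      simpa using (this.tendsto 0).mono_left nhdsWithin_le_nhds
    · filter_upwards [Ioo_mem_nhdsGT (zero_lt_one (α := ℝ))] with w hw
      exact Set.mem_Ioi.2 (by nlinarith [hw.1, hw.2])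
  exact h1.pos_mul_atTop hk (tendsto_inv_nhdsGT_zero.comp h2)

lemma tendsto_errMeanLim_zero (hS : S.PosSemidef) (hS0 : S ≠ 0) (hn : 2 ≤ n) (hm : 2 ≤ m) :
    Tendsto (fun w ↦ errMeanLim (μ, S) n m w) (𝓝[>] (0 : ℝ)) (𝓝 ⊤) := by
  have hs := trace_pos hS hS0
  have hn' : (0 : ℝ) < n := by positivity
  have hm' : (0 : ℝ) < m := by positivity
  have h := ENNReal.tendsto_ofReal_atTop.comp (((tendsto_weightConst_zero
    (div_pos hn' hm')).atTop_mul_const hs).atTop_div_const hn')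
  refine h.congr' ?_
  filter_upwards [Ioc_mem_nhdsGT (zero_lt_one (α := ℝ))] with w hw
  rw [errMeanLim_eq hS hn hm hw]
  rfl

lemma tendsto_errCovLim_zero (hS : S.PosSemidef) (hS0 : S ≠ 0) (hn : 2 ≤ n) (hm : 2 ≤ m) :
    Tendsto (fun w ↦ errCovLim (μ, S) n m w) (𝓝[>] (0 : ℝ)) (𝓝 ⊤) := by
  have hc : Continuous fun w : ℝ ↦ (1 - w) ^ 2 * (1 + 2 / ((m : ℝ) - 1)) := by fun_prop
  -- Unlike the mean error, which blows up through `weightConst`, the covariance error equals `⊤` on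
  -- a whole right neighbourhood of `0`.
  refine tendsto_const_nhds.congr' ?_
  filter_upwards [Ioc_mem_nhdsGT (zero_lt_one (α := ℝ)),
    ((hc.tendsto 0).mono_left nhdsWithin_le_nhds).eventually_const_lt (one_lt_growth_zero hm)]
    with w hw h
  exact (errCovLim_eq_top hS hS0 hn hm ⟨hw.1.le, hw.2⟩ h.le).symm

/-! ### The optimal weight -/

section OptWeight

variable {k : ℝ}

lemma optWeight_sq (hk : 0 < k) : optWeight k ^ 2 = k * (1 - optWeight k) := by
  have h := Real.sq_sqrt (show 0 ≤ k ^ 2 + 4 * k by positivity)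
  rw [optWeight]
  linear_combination h / 4

lemma optWeight_pos (hk : 0 < k) : 0 < optWeight k := by
  have : k < Real.sqrt (k ^ 2 + 4 * k) := Real.lt_sqrt_of_sq_lt (by linarith)
  rw [optWeight]
  linarith

lemma optWeight_lt_one (hk : 0 < k) : optWeight k < 1 := by
  nlinarith [optWeight_sq hk, optWeight_pos hk]

/-- Modulo the quadratic equation `optWeight_sq`, the numerator of the difference is a perfect
square up to a positive factor. This gives both the unique minimizer and the minimum value. -/
lemma weightConst_sub_optWeight (hk : 0 < k) (hw : w ∈ Set.Ioc (0 : ℝ) 1) :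
    weightConst w k - optWeight k =
      (1 + k + optWeight k) * (w - optWeight k) ^ 2 / (2 * w - w ^ 2) := by
  have h : 2 * w - w ^ 2 ≠ 0 := by nlinarith [hw.1, hw.2]
  rw [weightConst, eq_div_iff h, sub_mul, div_mul_cancel₀ _ h]
  linear_combination (2 * w - 1 - optWeight k) * optWeight_sq hk

lemma weightConst_optWeight (hk : 0 < k) : weightConst (optWeight k) k = optWeight k := by
  have h := weightConst_sub_optWeight hk ⟨optWeight_pos hk, (optWeight_lt_one hk).le⟩
  rw [sub_self] at h
  linarith [show (1 + k + optWeight k) * (0 : ℝ) ^ 2 /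
    (2 * optWeight k - optWeight k ^ 2) = 0 by simp]

lemma optWeight_lt_weightConst (hk : 0 < k) (hw : w ∈ Set.Ioc (0 : ℝ) 1) (hne : w ≠ optWeight k) :
    optWeight k < weightConst w k := by
  have h1 := weightConst_sub_optWeight hk hw
  have h2 : 0 < 2 * w - w ^ 2 := by nlinarith [hw.1, hw.2]
  have h3 := optWeight_pos hk
  have h4 : 0 < (w - optWeight k) ^ 2 := by
    have := sub_ne_zero.2 hne
    positivity
  have : 0 < weightConst w k - optWeight k := by rw [h1]; positivity
  linarith

lemma weightConst_one (k : ℝ) : weightConst 1 k = 1 := by norm_num [weightConst]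

end OptWeight

/-! ### Asymptotics for proportional sample sizes -/

section Proportional

variable {k : ℝ}

lemma tendsto_fst_proportional (k : ℝ) :
    Tendsto (fun q : ℕ × ℕ ↦ (q.1 : ℝ)) (proportional k) atTop :=
  (tendsto_natCast_atTop_atTop.comp tendsto_fst).mono_left inf_le_left

lemma tendsto_snd_proportional (k : ℝ) :
    Tendsto (fun q : ℕ × ℕ ↦ (q.2 : ℝ)) (proportional k) atTop :=
  (tendsto_natCast_atTop_atTop.comp tendsto_snd).mono_left inf_le_left

lemma tendsto_ratio_proportional (k : ℝ) :
    Tendsto (fun q : ℕ × ℕ ↦ (q.1 : ℝ) / q.2) (proportional k) (𝓝 k) :=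
  tendsto_comap.mono_left inf_le_right

lemma eventually_two_le_proportional (k : ℝ) :
    ∀ᶠ q in proportional k, 2 ≤ q.1 ∧ 2 ≤ q.2 := by
  filter_upwards [(tendsto_fst_proportional k).eventually_ge_atTop 2,
    (tendsto_snd_proportional k).eventually_ge_atTop 2] with q h1 h2
  exact ⟨by exact_mod_cast h1, by exact_mod_cast h2⟩

lemma tendsto_div_sub_one : Tendsto (fun x : ℝ ↦ x / (x - 1)) atTop (𝓝 1) := by
  have h := ((tendsto_inv_atTop_zero (𝕜 := ℝ)).const_sub 1).inv₀ (by norm_num)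
  rw [sub_zero, inv_one] at h
  refine h.congr' ?_
  filter_upwards [eventually_gt_atTop 1] with x hx
  have h1 : x ≠ 0 := by linarith
  have h2 : x - 1 ≠ 0 := by linarith
  field_simp

lemma tendsto_inv_sub_one (c : ℝ) : Tendsto (fun x : ℝ ↦ c / (x - 1)) atTop (𝓝 0) :=
  (tendsto_atTop_add_const_right _ (-1) tendsto_id).const_div_atTop c

lemma tendsto_mul_covForcing (k w : ℝ) :
    Tendsto (fun q : ℕ × ℕ ↦ (q.1 : ℝ) * covForcing q.1 q.2 w) (proportional k)
      (𝓝 (w ^ 2 + (1 - w) ^ 2 * k)) := by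
  have h1 := (tendsto_div_sub_one.comp (tendsto_fst_proportional k)).const_mul (w ^ 2)
  have h2 := ((tendsto_ratio_proportional k).mul
    (tendsto_div_sub_one.comp (tendsto_snd_proportional k))).const_mul ((1 - w) ^ 2)
  have h := h1.add h2
  rw [mul_one, mul_one] at h
  refine h.congr' ?_
  filter_upwards [eventually_two_le_proportional k] with q hq
  have : (q.2 : ℝ) ≠ 0 := by have := hq.2; positivity
  simp only [Function.comp, covForcing]
  rw [div_mul_div_comm, mul_comm (q.1 : ℝ) (q.2 : ℝ), mul_div_mul_left _ _ this]
  ring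

/-- Both denominators tend to `1 - (1 - w)² = 2w - w²`, so the two modes recombine: with `s = sumSq
S` and `t = S.trace`, `(4s + 2t²) + (t² - s) = 3(s + t²)`. -/
lemma tendsto_mul_covLimit (S : Matrix (Fin p) (Fin p) ℝ) (k : ℝ) (hw : w ∈ Set.Ioc (0 : ℝ) 1) :
    Tendsto (fun q : ℕ × ℕ ↦ (q.1 : ℝ) * covLimit S q.1 q.2 w) (proportional k)
      (𝓝 (weightConst w k * (sumSq S + S.trace ^ 2))) := by
  have hd : (1 : ℝ) - (1 - w) ^ 2 ≠ 0 := by nlinarith [hw.1, hw.2]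
  have hf := tendsto_mul_covForcing k w
  have h1 := (((tendsto_inv_sub_one 2).comp (tendsto_snd_proportional k)).const_add 1).const_mul
    ((1 - w) ^ 2)|>.const_sub 1
  have h2 := (((tendsto_inv_sub_one 1).comp (tendsto_snd_proportional k)).const_sub 1).const_mul
    ((1 - w) ^ 2)|>.const_sub 1
  rw [add_zero, mul_one] at h1
  rw [sub_zero, mul_one] at h2
  have h := (((hf.mul_const (4 * sumSq S + 2 * S.trace ^ 2)).div h1 hd).add
    ((hf.mul_const (S.trace ^ 2 - sumSq S)).div h2 hd)).div_const 3
  have e : weightConst w k * (sumSq S + S.trace ^ 2) =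
      ((w ^ 2 + (1 - w) ^ 2 * k) * (4 * sumSq S + 2 * S.trace ^ 2) / (1 - (1 - w) ^ 2) +
        (w ^ 2 + (1 - w) ^ 2 * k) * (S.trace ^ 2 - sumSq S) / (1 - (1 - w) ^ 2)) / 3 := by
    rw [weightConst, show 2 * w - w ^ 2 = 1 - (1 - w) ^ 2 by ring]
    field_simp
    ring
  rw [e]
  refine h.congr fun q ↦ ?_
  simp only [Function.comp, covLimit, Pi.div_apply]
  ring

lemma weightConst_pos (hk : 0 < k) (hw : w ∈ Set.Ioc (0 : ℝ) 1) : 0 < weightConst w k := by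
  have h := hw.1
  have : 0 < 2 * w - w ^ 2 := by nlinarith [hw.1, hw.2]
  unfold weightConst
  positivity

/-- For fixed `w > 0` the larger ratio tends to `(1 - w)² < 1`, so the regime is eventually
subcritical. Positivity comes from the positive limit of `n * covLimit`; it is needed to compare and
divide in `[0, ∞]`. -/
lemma eventually_errCovLim (μ : EuclideanSpace ℝ (Fin p)) (hS : S.PosSemidef) (hS0 : S ≠ 0)
    (hk : 0 < k) (hw : w ∈ Set.Ioc (0 : ℝ) 1) :
    ∀ᶠ q in proportional k, 0 < covLimit S q.1 q.2 w ∧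
      errCovLim (μ, S) q.1 q.2 w = ENNReal.ofReal (covLimit S q.1 q.2 w) := by
  have hs := trace_pos hS hS0
  have hs2 := sumSq_nonneg S
  have hC := weightConst_pos hk hw
  have h1 := (((tendsto_inv_sub_one 2).comp (tendsto_snd_proportional k)).const_add 1).const_mul
    ((1 - w) ^ 2)
  filter_upwards [eventually_two_le_proportional k,
    h1.eventually_lt_const (show (1 - w) ^ 2 * (1 + 0) < 1 by nlinarith [hw.1, hw.2]),
    (tendsto_mul_covLimit S k hw).eventually_const_lt (mul_pos hC (by positivity))] with q hq hlt hpos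
  exact ⟨pos_of_mul_pos_right hpos (Nat.cast_nonneg _),
    errCovLim_eq hS hq.1 hq.2 ⟨hw.1.le, hw.2⟩ hlt⟩

lemma eventually_errCovLim_lt (μ : EuclideanSpace ℝ (Fin p)) (hS : S.PosSemidef) (hS0 : S ≠ 0)
    (hk : 0 < k) (hw : w ∈ Set.Icc (0 : ℝ) 1) (hne : w ≠ optWeight k) :
    ∀ᶠ q in proportional k,
      errCovLim (μ, S) q.1 q.2 (optWeight k) < errCovLim (μ, S) q.1 q.2 w := by
  have hopt : optWeight k ∈ Set.Ioc (0 : ℝ) 1 := ⟨optWeight_pos hk, (optWeight_lt_one hk).le⟩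
  rcases hw.1.eq_or_lt with rfl | h0
  -- At `w = 0` there is no leading coefficient to compare: the error is infinite there and finite
  -- at the optimal weight.
  · filter_upwards [eventually_two_le_proportional k, eventually_errCovLim μ hS hS0 hk hopt]
      with q hq h
    rw [errCovLim_eq_top hS hS0 hq.1 hq.2 hw (one_lt_growth_zero hq.2).le, h.2]
    exact ENNReal.ofReal_lt_top
  · have hw' : w ∈ Set.Ioc (0 : ℝ) 1 := ⟨h0, hw.2⟩
    have hlt : weightConst (optWeight k) k * (sumSq S + S.trace ^ 2) <
        weightConst w k * (sumSq S + S.trace ^ 2) := by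
      have hs := trace_pos hS hS0
      have hs2 := sumSq_nonneg S
      rw [weightConst_optWeight hk]
      exact mul_lt_mul_of_pos_right (optWeight_lt_weightConst hk hw' hne) (by positivity)
    filter_upwards [eventually_errCovLim μ hS hS0 hk hopt, eventually_errCovLim μ hS hS0 hk hw',
      (tendsto_mul_covLimit S k hopt).eventually_lt (tendsto_mul_covLimit S k hw') hlt]
      with q h1 h2 h3
    rw [h1.2, h2.2, ENNReal.ofReal_lt_ofReal_iff h2.1]
    exact lt_of_mul_lt_mul_left h3 (Nat.cast_nonneg _)

lemma isLittleO_errCovLim (μ : EuclideanSpace ℝ (Fin p)) (hS : S.PosSemidef) (hS0 : S ≠ 0)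
    (hk : 0 < k) (hw : w ∈ Set.Ioc (0 : ℝ) 1) :
    (fun q : ℕ × ℕ ↦ (errCovLim (μ, S) q.1 q.2 w).toReal -
      weightConst w k * ((S ^ 2).trace + S.trace ^ 2) / q.1)
      =o[proportional k] (fun q : ℕ × ℕ ↦ 1 / (q.1 : ℝ)) := by
  rw [trace_sq_eq_sumSq hS]
  refine (isLittleO_iff_tendsto' ?_).2 ?_
  · filter_upwards [eventually_two_le_proportional k] with q hq h
    have : (q.1 : ℝ) ≠ 0 := by have := hq.1; positivity
    exact absurd h (by positivity)
  · have h := (tendsto_mul_covLimit S k hw).sub_const (weightConst w k * (sumSq S + S.trace ^ 2))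
    rw [sub_self] at h
    refine h.congr' ?_
    filter_upwards [eventually_two_le_proportional k, eventually_errCovLim μ hS hS0 hk hw]
      with q hq h
    have : (q.1 : ℝ) ≠ 0 := by have := hq.1; positivity
    rw [h.2, ENNReal.toReal_ofReal h.1.le]
    field_simp

lemma tendsto_errCovLim_ratio (μ : EuclideanSpace ℝ (Fin p)) (hS : S.PosSemidef) (hS0 : S ≠ 0)
    (hk : 0 < k) :
    Tendsto (fun q : ℕ × ℕ ↦
        errCovLim (μ, S) q.1 q.2 (optWeight k) / errCovLim (μ, S) q.1 q.2 1)
      (proportional k) (𝓝 (ENNReal.ofReal (optWeight k))) := by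
  have hs := trace_pos hS hS0
  have hs2 := sumSq_nonneg S
  have hopt : optWeight k ∈ Set.Ioc (0 : ℝ) 1 := ⟨optWeight_pos hk, (optWeight_lt_one hk).le⟩
  have hone : (1 : ℝ) ∈ Set.Ioc (0 : ℝ) 1 := ⟨one_pos, le_rfl⟩
  have hL : sumSq S + S.trace ^ 2 ≠ 0 := by positivity
  have h := (tendsto_mul_covLimit S k hopt).div (tendsto_mul_covLimit S k hone)
    (by rwa [weightConst_one, one_mul])
  rw [weightConst_one, one_mul, mul_div_cancel_right₀ _ hL, weightConst_optWeight hk] at h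
  refine ((ENNReal.continuous_ofReal.tendsto _).comp h).congr' ?_
  filter_upwards [eventually_two_le_proportional k, eventually_errCovLim μ hS hS0 hk hopt,
    eventually_errCovLim μ hS hS0 hk hone] with q hq h1 h2
  have : (q.1 : ℝ) ≠ 0 := by have := hq.1; positivity
  rw [h1.2, h2.2, ← ENNReal.ofReal_div_of_pos h2.1]
  simp only [Function.comp, Pi.div_apply]
  rw [mul_div_mul_left _ _ this]

lemma errMeanLim_div (hS : S.PosSemidef) (hS0 : S ≠ 0) (hn : 2 ≤ n) (hm : 2 ≤ m)
    (hw : w ∈ Set.Ioc (0 : ℝ) 1) :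
    errMeanLim (μ, S) n m w / errMeanLim (μ, S) n m 1 =
      ENNReal.ofReal (weightConst w ((n : ℝ) / m)) := by
  have hs := trace_pos hS hS0
  have hn0 : (0 : ℝ) < n := by positivity
  rw [errMeanLim_eq hS hn hm hw, errMeanLim_eq hS hn hm ⟨one_pos, le_rfl⟩, weightConst_one,
    one_mul, ← ENNReal.ofReal_div_of_pos (by positivity), mul_div_assoc,
    mul_div_cancel_right₀ _ (by positivity)]

/-- The weight is frozen at the limiting `k` while `n/m` only approaches it, so the ratio is
`weightConst (optWeight k) (n/m)` and continuity in the second argument concludes. -/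
lemma tendsto_errMeanLim_ratio (μ : EuclideanSpace ℝ (Fin p)) (hS : S.PosSemidef) (hS0 : S ≠ 0)
    (hk : 0 < k) :
    Tendsto (fun q : ℕ × ℕ ↦
        errMeanLim (μ, S) q.1 q.2 (optWeight k) / errMeanLim (μ, S) q.1 q.2 1)
      (proportional k) (𝓝 (ENNReal.ofReal (optWeight k))) := by
  have hopt : optWeight k ∈ Set.Ioc (0 : ℝ) 1 := ⟨optWeight_pos hk, (optWeight_lt_one hk).le⟩
  have hc : Continuous fun k' ↦ weightConst (optWeight k) k' := by
    unfold weightConst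
    fun_prop
  have h := (ENNReal.continuous_ofReal.tendsto _).comp
    ((hc.tendsto k).comp (tendsto_ratio_proportional k))
  rw [weightConst_optWeight hk] at h
  refine h.congr' ?_
  filter_upwards [eventually_two_le_proportional k] with q hq
  rw [errMeanLim_div hS hS0 hq.1 hq.2 hopt]
  rfl

end Proportional

end RecursiveGaussian

/-! ### The main theorem -/

theorem corollary1 {p : ℕ} (μ : EuclideanSpace ℝ (Fin p)) (S : Matrix (Fin p) (Fin p) ℝ)
    (hS : S.PosSemidef) (hS0 : S ≠ 0) :
    -- the limits as `t → ∞` defining the limiting errors exist in `[0, ∞]`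
    (∀ n m : ℕ, 2 ≤ n → 2 ≤ m → ∀ w ∈ Set.Icc (0 : ℝ) 1,
      Tendsto (RecursiveGaussian.errMean (μ, S) n m w) atTop
        (𝓝 (RecursiveGaussian.errMeanLim (μ, S) n m w)) ∧
      Tendsto (RecursiveGaussian.errCov (μ, S) n m w) atTop
        (𝓝 (RecursiveGaussian.errCovLim (μ, S) n m w))) ∧
    -- (1) collapse as `w → 0⁺`
    (∀ n m : ℕ, 2 ≤ n → 2 ≤ m →
      Tendsto (fun w => RecursiveGaussian.errMeanLim (μ, S) n m w) (𝓝[>] (0 : ℝ)) (𝓝 ⊤) ∧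
      Tendsto (fun w => RecursiveGaussian.errCovLim (μ, S) n m w) (𝓝[>] (0 : ℝ)) (𝓝 ⊤)) ∧
    -- (2) real data only
    (∀ n m : ℕ, 2 ≤ n → 2 ≤ m →
      RecursiveGaussian.errMeanLim (μ, S) n m 1 = ENNReal.ofReal (S.trace / n) ∧
      RecursiveGaussian.errCovLim (μ, S) n m 1 =
        ENNReal.ofReal (((S ^ 2).trace + S.trace ^ 2) / ((n : ℝ) - 1))) ∧
    -- (3) the unique optimal weight on `[0, 1]` for the mean, with `k = n / m`
    (∀ n m : ℕ, 2 ≤ n → 2 ≤ m →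
      RecursiveGaussian.optWeight ((n : ℝ) / m) ∈ Set.Icc (0 : ℝ) 1 ∧
      (∀ w ∈ Set.Icc (0 : ℝ) 1, w ≠ RecursiveGaussian.optWeight ((n : ℝ) / m) →
        RecursiveGaussian.errMeanLim (μ, S) n m (RecursiveGaussian.optWeight ((n : ℝ) / m)) <
          RecursiveGaussian.errMeanLim (μ, S) n m w) ∧
      RecursiveGaussian.errMeanLim (μ, S) n m (RecursiveGaussian.optWeight ((n : ℝ) / m)) =
        ENNReal.ofReal (RecursiveGaussian.optWeight ((n : ℝ) / m) * S.trace / n)) ∧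
    -- (4) first-order asymptotics of the covariance error as `n, m → ∞` with `n / m → k`
    (∀ k : ℝ, 0 < k → ∀ w ∈ Set.Ioc (0 : ℝ) 1,
      (∀ᶠ q in RecursiveGaussian.proportional k,
        RecursiveGaussian.errCovLim (μ, S) q.1 q.2 w ≠ ⊤) ∧
      (fun q : ℕ × ℕ => (RecursiveGaussian.errCovLim (μ, S) q.1 q.2 w).toReal -
          RecursiveGaussian.weightConst w k * ((S ^ 2).trace + S.trace ^ 2) / q.1)
        =o[RecursiveGaussian.proportional k] (fun q : ℕ × ℕ => 1 / (q.1 : ℝ))) ∧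
    -- (4, continued) the asymptotically optimal weight for the covariance: it is the unique
    -- minimizer of the leading coefficient, and it eventually beats any other weight in `[0, 1]`
    (∀ k : ℝ, 0 < k →
      RecursiveGaussian.optWeight k ∈ Set.Ioc (0 : ℝ) 1 ∧
      (∀ w ∈ Set.Ioc (0 : ℝ) 1, w ≠ RecursiveGaussian.optWeight k →
        RecursiveGaussian.weightConst (RecursiveGaussian.optWeight k) k *
            ((S ^ 2).trace + S.trace ^ 2) <
          RecursiveGaussian.weightConst w k * ((S ^ 2).trace + S.trace ^ 2)) ∧
      (∀ w ∈ Set.Icc (0 : ℝ) 1, w ≠ RecursiveGaussian.optWeight k →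
        ∀ᶠ q in RecursiveGaussian.proportional k,
          RecursiveGaussian.errCovLim (μ, S) q.1 q.2 (RecursiveGaussian.optWeight k) <
            RecursiveGaussian.errCovLim (μ, S) q.1 q.2 w)) ∧
    -- (5) improvement over real data only
    (∀ n m : ℕ, 2 ≤ n → 2 ≤ m →
      RecursiveGaussian.errMeanLim (μ, S) n m (RecursiveGaussian.optWeight ((n : ℝ) / m)) /
          RecursiveGaussian.errMeanLim (μ, S) n m 1 =
        ENNReal.ofReal (RecursiveGaussian.optWeight ((n : ℝ) / m))) ∧
    (∀ k : ℝ, 0 < k →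
      Tendsto (fun q : ℕ × ℕ =>
          RecursiveGaussian.errMeanLim (μ, S) q.1 q.2 (RecursiveGaussian.optWeight k) /
            RecursiveGaussian.errMeanLim (μ, S) q.1 q.2 1)
        (RecursiveGaussian.proportional k)
        (𝓝 (ENNReal.ofReal (RecursiveGaussian.optWeight k))) ∧
      Tendsto (fun q : ℕ × ℕ =>
          RecursiveGaussian.errCovLim (μ, S) q.1 q.2 (RecursiveGaussian.optWeight k) /
            RecursiveGaussian.errCovLim (μ, S) q.1 q.2 1)
        (RecursiveGaussian.proportional k)
        (𝓝 (ENNReal.ofReal (RecursiveGaussian.optWeight k))) ∧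
      RecursiveGaussian.optWeight k < 1) := by
  have opt {k : ℝ} (hk : 0 < k) : RecursiveGaussian.optWeight k ∈ Set.Ioc (0 : ℝ) 1 :=
    ⟨RecursiveGaussian.optWeight_pos hk, (RecursiveGaussian.optWeight_lt_one hk).le⟩
  have ratio_pos {n m : ℕ} (hn : 2 ≤ n) (hm : 2 ≤ m) : 0 < (n : ℝ) / m := by positivity
  have htr := RecursiveGaussian.trace_pos hS hS0
  refine ⟨fun n m hn hm w hw ↦ ⟨RecursiveGaussian.tendsto_errMean_errMeanLim hS hS0 hn hm hw,
      RecursiveGaussian.tendsto_errCov_errCovLim hS hS0 hn hm hw⟩,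
    fun n m hn hm ↦ ⟨RecursiveGaussian.tendsto_errMeanLim_zero hS hS0 hn hm,
      RecursiveGaussian.tendsto_errCovLim_zero hS hS0 hn hm⟩,
    fun n m hn hm ↦ ⟨?_, RecursiveGaussian.errCovLim_one hS hn hm⟩,
    fun n m hn hm ↦ ?_, fun k hk w hw ↦ ⟨?_, RecursiveGaussian.isLittleO_errCovLim μ hS hS0 hk hw⟩,
    fun k hk ↦ ⟨opt hk, fun w hw hne ↦ ?_, fun w hw hne ↦
      RecursiveGaussian.eventually_errCovLim_lt μ hS hS0 hk hw hne⟩,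
    fun n m hn hm ↦ ?_,
    fun k hk ↦ ⟨RecursiveGaussian.tendsto_errMeanLim_ratio μ hS hS0 hk,
      RecursiveGaussian.tendsto_errCovLim_ratio μ hS hS0 hk,
      RecursiveGaussian.optWeight_lt_one hk⟩⟩
  · rw [RecursiveGaussian.errMeanLim_eq hS hn hm ⟨one_pos, le_rfl⟩,
      RecursiveGaussian.weightConst_one, one_mul]
  · have hk := ratio_pos hn hm
    have hn0 : (0 : ℝ) < n := by positivity
    have heq := RecursiveGaussian.errMeanLim_eq (μ := μ) hS hn hm (opt hk)
    rw [RecursiveGaussian.weightConst_optWeight hk] at heq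
    refine ⟨⟨(opt hk).1.le, (opt hk).2⟩, fun w hw hne ↦ ?_, heq⟩
    rw [heq]
    rcases hw.1.eq_or_lt with rfl | h0
    · rw [RecursiveGaussian.errMeanLim_zero hS hS0 hn hm]
      exact ENNReal.ofReal_lt_top
    · have hlt := RecursiveGaussian.optWeight_lt_weightConst hk ⟨h0, hw.2⟩ hne
      -- `ENNReal.ofReal` preserves a strict inequality only when the larger side is positive.
      have hpos := (opt hk).1.trans hlt
      rw [RecursiveGaussian.errMeanLim_eq hS hn hm ⟨h0, hw.2⟩,
        ENNReal.ofReal_lt_ofReal_iff (by positivity)]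
      gcongr
  · filter_upwards [RecursiveGaussian.eventually_errCovLim μ hS hS0 hk hw] with q hq
    rw [hq.2]
    exact ENNReal.ofReal_ne_top
  · rw [RecursiveGaussian.weightConst_optWeight hk, RecursiveGaussian.trace_sq_eq_sumSq hS]
    have := RecursiveGaussian.sumSq_nonneg S
    exact mul_lt_mul_of_pos_right (RecursiveGaussian.optWeight_lt_weightConst hk hw hne)
      (by positivity)
  · rw [RecursiveGaussian.errMeanLim_div hS hS0 hn hm (opt (ratio_pos hn hm)),
      RecursiveGaussian.weightConst_optWeight (ratio_pos hn hm)]
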